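/- Consider the linear system $x_{t+1}=Ax_t+Bu_t+F\theta\,\mathbf 1_{\{t\ge \nu\}}+w_t$, $t=0,1,2,\dots$, with $x_t\in\mathbb R^n$, $u_t\in\mathbb R^m$, $\theta\in\mathbb R^k$, where the noise $(w_t)$ is i.i.d. $\mathcal N(0,Q)$ with $Q\succ0$ and independent of the square-integrable initial state $x_0$. Assume that the columns of $B$ are linearly independent and that $K\in\mathbb R^{m\times n}$ is such that $A+BK$ is a Schur matrix (all its eigenvalues lie in the open unit disc). Put $L=I-A-BK$ and $E=(L^{-1})^\top L^{-1}$. The control is $u_t=Kx_t+\alpha_0$ for $t<\nu$ and $u_t=Kx_t+\alpha_1$ for $t\ge\nu$, with $\alpha_0,\alpha_1\in\mathbb R^m$, and the reward is $r(x,u)=-x^\top x$. Let $V_0$ (resp. $V_1$) be the ergodic reward $\lim_{N\to\infty}\mathbb E\big[\frac1N\sum_{t=0}^{N-1} r(x_t,u_t)\big]$ of the system that never changes ($\nu=\infty$) (resp. that has changed from the start, $\nu=0$). An eavesdropper observes only the states. Let $f_0(\cdot|x)$ and $f_1(\cdot|x)$ be the Gaussian densities of $x_{t+1}$ given $x_t=x$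 before and after the change, and $Z_t=\ln\frac{f_1(x_{t+1}|x_t)}{f_0(x_{t+1}|x_t)}$. The information rate $I_L(\alpha_0,\alpha_1)$ (the inverse of the privacy level) is the constant $I$ such that, for every change time $\nu$, $\frac1n\sum_{t=\nu}^{\nu+n}Z_t\to I$ almost surely, and, if $I\ne0$, for every $\delta>0$, $$\lim_{n\to\infty}\ \sup_{\nu}\ \operatorname{ess\,sup}\ \mathbb P_\nu\Big(\max_{t\le n}\sum_{i=\nu}^{\nu+t}Z_i\ge I(1+\delta)n\,\Big|\,x_0,\dots,x_\nu\Big)=0 .$$ For $\rho\in[0,1]$ and $\lambda\ge0$ the utility-privacy value is $V_L(\rho,\lambda,\alpha_0,\alpha_1)=(1-\rho)V_0+\rho V_1-\lambda I_L(\alpha_0,\alpha_1)$. Then $V_0$, $V_1$ and $I_L$ exist for all $\alpha_0,\alpha_1$; the equation $\Sigma=(A+BK)\Sigma(A+BK)^\top+Q$ has exactly one solution $\Sigma$; $$I_L(\alpha_0,\alpha_1)=\tfrac12\big(F\theta+B(\alpha_1-\alpha_0)\big)^\top Q^{-1}\big(F\theta+B(\alpha_1-\alpha_0)\big),$$ and,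 for $\rho\in[0,1]$, $\lambda\ge0$, $$V_L(\rho,\lambda,\alpha_0,\alpha_1)=-(1-\rho)\alpha_0^\top B^\top EB\alpha_0-\mathrm{Tr}(\Sigma)-\rho(B\alpha_1+F\theta)^\top E(B\alpha_1+F\theta)-\tfrac{\lambda}{2}\big(F\theta+B(\alpha_1-\alpha_0)\big)^\top Q^{-1}\big(F\theta+B(\alpha_1-\alpha_0)\big).$$ For square matrices $M,T$ put $\tilde B_T(M)=\big(B^\top(M+T)B\big)^{-1}B^\top M$. For $\lambda>0$ and $\rho\in[0,1]$ the function $(\alpha_0,\alpha_1)\mapsto V_L(\rho,\lambda,\alpha_0,\alpha_1)$ has exactly one maximizer, namely $$\alpha_1^\star(\rho,\lambda)=-\tilde B_0\Big((1-\rho)EB\tilde B_{2(1-\rho)E/\lambda}(Q^{-1})+\rho E\Big)F\theta,\qquad \alpha_0^\star(\rho,\lambda)=\tilde B_{2(1-\rho)E/\lambda}(Q^{-1})\big(F\theta+B\alpha_1^\star(\rho,\lambda)\big),$$ where all the inverses that occur exist. These simplify to $\alpha_0^\star=0$, $\alpha_1^\star=-\tilde B_0(Q^{-1})F\theta$ if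 $\rho=0$, and to $\alpha_0^\star=\tilde B_0(Q^{-1})(I-B\tilde B_0(E))F\theta$, $\alpha_1^\star=-\tilde B_0(E)F\theta$ if $\rho=1$. Moreover, for $\lambda>0$, the only maximizer of $\alpha_1\mapsto V_L(1,\lambda,0,\alpha_1)$ (the problem with $\alpha_0=0$) is $\alpha_1^\star(\lambda)=-\tilde B_0\big(\tfrac2\lambda E+Q^{-1}\big)F\theta$. -/

import Mathlib

open MeasureTheory ProbabilityTheory Filter Topology Matrix

/-! ### Gaussian vectors -/

/-- The Gaussian law `N(μ, Q)` on `ℝⁿ`. -/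
noncomputable def gaussianLaw {n : ℕ} (μ : Fin n → ℝ) (Q : Matrix (Fin n) (Fin n) ℝ) :
    Measure (Fin n → ℝ) :=
  (multivariateGaussian (WithLp.toLp 2 μ) Q).map WithLp.ofLp

/-- The density of `N(μ, Q)`, for `Q` positive definite. -/
noncomputable def gaussianDensity {n : ℕ} (μ : Fin n → ℝ) (Q : Matrix (Fin n) (Fin n) ℝ)
    (y : Fin n → ℝ) : ℝ :=
  (Real.sqrt ((2 * Real.pi) ^ n * Q.det))⁻¹ *
    Real.exp (-((y - μ) ⬝ᵥ Q⁻¹ *ᵥ (y - μ)) / 2)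

theorem pi_gaussianReal_eq_withDensity (n : ℕ) :
    Measure.pi (fun _ : Fin n => gaussianReal 0 1) =
      (volume : Measure (Fin n → ℝ)).withDensity
        (fun y => ENNReal.ofReal (∏ i, gaussianPDFReal 0 1 (y i))) := by
  apply Measure.pi_eq
  intro s hs
  rw [withDensity_apply _ (MeasurableSet.univ_pi hs), ← lintegral_indicator (MeasurableSet.univ_pi hs)]
  have h1 : ∀ y : Fin n → ℝ, (Set.univ.pi s).indicator
      (fun y => ENNReal.ofReal (∏ i, gaussianPDFReal 0 1 (y i))) y =
      ENNReal.ofReal (∏ i, (s i).indicator (gaussianPDFReal 0 1) (y i)) := by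
    intro y
    by_cases hy : y ∈ Set.univ.pi s
    · rw [Set.indicator_of_mem hy]
      congr 1
      refine Finset.prod_congr rfl fun i _ => ?_
      rw [Set.indicator_of_mem (hy i (Set.mem_univ i))]
    · rw [Set.indicator_of_notMem hy]
      simp only [Set.mem_pi, Set.mem_univ, true_imp_iff, not_forall] at hy
      obtain ⟨i, hi⟩ := hy
      rw [Finset.prod_eq_zero (Finset.mem_univ i) (Set.indicator_of_notMem hi _)]
      simp
  have hnn : ∀ i x, 0 ≤ (s i).indicator (gaussianPDFReal 0 1) x := fun i x =>
    Set.indicator_nonneg (fun x _ => gaussianPDFReal_nonneg 0 1 x) x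
  have hint : ∀ i, Integrable ((s i).indicator (gaussianPDFReal 0 1)) := fun i =>
    (integrable_gaussianPDFReal 0 1).indicator (hs i)
  simp_rw [h1]
  have hI : Integrable (fun y : Fin n → ℝ => ∏ i, (s i).indicator (gaussianPDFReal 0 1) (y i)) :=
    Integrable.fintype_prod (f := fun i => (s i).indicator (gaussianPDFReal 0 1)) hint
  rw [← ofReal_integral_eq_lintegral_ofReal hI
    (ae_of_all _ fun y => Finset.prod_nonneg fun i _ => hnn i _),
    integral_fintype_prod_volume_eq_prod (f := fun i => (s i).indicator (gaussianPDFReal 0 1)),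
    ENNReal.ofReal_prod_of_nonneg fun i _ => integral_nonneg (hnn i)]
  refine Finset.prod_congr rfl fun i _ => ?_
  rw [gaussianReal_of_var_ne_zero 0 one_ne_zero, withDensity_apply _ (hs i),
    integral_indicator (hs i),
    ofReal_integral_eq_lintegral_ofReal (integrable_gaussianPDFReal 0 1).integrableOn
      (ae_of_all _ fun x => gaussianPDFReal_nonneg 0 1 x)]
  rfl

theorem prod_gaussianPDFReal {n : ℕ} (z : Fin n → ℝ) :
    ∏ i, gaussianPDFReal 0 1 (z i) =
      (Real.sqrt ((2 * Real.pi) ^ n))⁻¹ * Real.exp (-(z ⬝ᵥ z) / 2) := by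
  simp only [gaussianPDFReal, Finset.prod_mul_distrib, Finset.prod_const, ← Real.exp_sum,
    Finset.card_univ, Fintype.card_fin, NNReal.coe_one, mul_one, sub_zero]
  congr 1
  · rw [inv_pow]
    congr 1
    symm
    apply (Real.sqrt_eq_iff_mul_self_eq (by positivity) (by positivity)).2
    rw [← mul_pow, Real.mul_self_sqrt (by positivity)]
  · congr 1
    simp [dotProduct, Finset.sum_div, neg_div, pow_two]


open scoped MatrixOrder in
/-- `gaussianDensity μ Q` is indeed the Lebesgue density of `N(μ, Q)`. -/
theorem gaussianLaw_eq_withDensity {n : ℕ} (μ : Fin n → ℝ) {Q : Matrix (Fin n) (Fin n) ℝ}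
    (hQ : Q.PosDef) :
    gaussianLaw μ Q =
      (volume : Measure (Fin n → ℝ)).withDensity
        (fun y => ENNReal.ofReal (gaussianDensity μ Q y)) := by
  classical
  set R := CFC.sqrt Q with hR
  have hRR : R * R = Q := CFC.sqrt_mul_sqrt_self _ hQ.posSemidef.nonneg
  have hRdet : R.det = Real.sqrt Q.det := by
    have h := hQ.posSemidef.det_sqrt
    rw [← hR] at h
    rw [h, RCLike.sqrt_of_nonneg hQ.posSemidef.det_nonneg]
    simp
  have hdetpos : 0 < R.det := by rw [hRdet]; exact Real.sqrt_pos.2 hQ.det_pos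
  have hRT : Rᵀ = R := by
    have h : IsSelfAdjoint R := (CFC.sqrt_nonneg Q).isSelfAdjoint
    simpa [Matrix.star_eq_conjTranspose] using h.star_eq
  have hRu : IsUnit R.det := hdetpos.ne'.isUnit
  have hquad : ∀ z : Fin n → ℝ, (R *ᵥ z) ⬝ᵥ Q⁻¹ *ᵥ (R *ᵥ z) = z ⬝ᵥ z := by
    intro z
    rw [← hRR, Matrix.mul_inv_rev, Matrix.mulVec_mulVec, Matrix.mul_assoc,
      Matrix.nonsing_inv_mul _ hRu, Matrix.mul_one, Matrix.dotProduct_mulVec,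
      ← Matrix.mulVec_transpose, Matrix.transpose_nonsing_inv, hRT, Matrix.mulVec_mulVec,
      Matrix.nonsing_inv_mul _ hRu, Matrix.one_mulVec]
  set T : (Fin n → ℝ) → (Fin n → ℝ) := fun z => μ + R *ᵥ z with hT
  have hTm : Measurable T := by
    apply Continuous.measurable
    fun_prop
  have hlaw : gaussianLaw μ Q = (Measure.pi (fun _ : Fin n => gaussianReal 0 1)).map T := by
    rw [gaussianLaw, multivariateGaussian, ← map_pi_eq_stdGaussian,
      Measure.map_map (by fun_prop) (by fun_prop), Measure.map_map (by fun_prop) (by fun_prop)]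
    rfl
  have hvol : (volume : Measure (Fin n → ℝ)).map T = ENNReal.ofReal (R.det)⁻¹ • volume := by
    have h1 : T = (fun y => μ + y) ∘ (Matrix.toLin' R) := by
      ext z i; simp [hT]
    rw [h1, ← Measure.map_map (measurable_const_add μ) (LinearMap.continuous_on_pi _).measurable,
      Real.map_matrix_volume_pi_eq_smul_volume_pi hdetpos.ne', Measure.map_smul,
      (measurePreserving_add_left volume μ).map_eq, abs_of_pos (inv_pos.2 hdetpos)]
  have hdm : Measurable (fun y => ENNReal.ofReal (gaussianDensity μ Q y)) := by
    apply Measurable.ennreal_ofReal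
    apply Continuous.measurable
    unfold gaussianDensity
    fun_prop
  have hpt : ∀ z : Fin n → ℝ, ENNReal.ofReal (∏ i, gaussianPDFReal 0 1 (z i)) =
      ENNReal.ofReal R.det * ENNReal.ofReal (gaussianDensity μ Q (T z)) := by
    intro z
    rw [← ENNReal.ofReal_mul hdetpos.le, prod_gaussianPDFReal, gaussianDensity]
    simp only [hT, add_sub_cancel_left, hquad]
    rw [Real.sqrt_mul (by positivity), ← hRdet]
    congr 1
    field_simp
  ext s hs
  rw [hlaw, pi_gaussianReal_eq_withDensity, Measure.map_apply hTm hs,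
    withDensity_apply _ (hTm hs), withDensity_apply _ hs]
  have hdT : Measurable (fun z => ENNReal.ofReal (gaussianDensity μ Q (T z))) := hdm.comp hTm
  simp_rw [hpt]
  rw [lintegral_const_mul _ hdT, ← setLIntegral_map hs hdm hTm, hvol,
    Measure.restrict_smul, lintegral_smul_measure, smul_eq_mul, ← mul_assoc,
    ← ENNReal.ofReal_mul hdetpos.le, mul_inv_cancel₀ hdetpos.ne', ENNReal.ofReal_one, one_mul]

/-! ### Reward and information of a process -/

/-- `N⁻¹ E[r(X₀) + ⋯ + r(X_{N-1})]` for the reward `r(x, u) = -xᵀx`. -/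
noncomputable def averageReward {n : ℕ} {Ω : Type*} [MeasurableSpace Ω] (P : Measure Ω)
    (X : ℕ → Ω → (Fin n → ℝ)) (N : ℕ) : ℝ :=
  ∫ ω, (N : ℝ)⁻¹ * ∑ t ∈ Finset.range N, -(X t ω ⬝ᵥ X t ω) ∂P

/-- The ergodic reward `lim_N N⁻¹ E[r(X₀) + ⋯ + r(X_{N-1})]`. -/
noncomputable def ergodicReward {n : ℕ} {Ω : Type*} [MeasurableSpace Ω] (P : Measure Ω)
    (X : ℕ → Ω → (Fin n → ℝ)) : ℝ :=
  limUnder atTop (averageReward P X)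

/-- All the rewards have a mean and the limit that defines the ergodic reward exists. -/
def HasErgodicReward {n : ℕ} {Ω : Type*} [MeasurableSpace Ω] (P : Measure Ω)
    (X : ℕ → Ω → (Fin n → ℝ)) : Prop :=
  (∀ t, Integrable (fun ω => -(X t ω ⬝ᵥ X t ω)) P) ∧
    Tendsto (averageReward P X) atTop (𝓝 (ergodicReward P X))

/-- The log-likelihood ratio of the observation `X_{t+1}` given `X₀, …, X_t`, for a Markov process
whose conditional density given the past is `f₁ X_t` after and `f₀ X_t` before the change. -/
noncomputable def logLikelihoodRatio {S Ω : Type*} (f₀ f₁ : S → S → ℝ) (X : ℕ → Ω → S) (t : ℕ)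
    (ω : Ω) : ℝ :=
  Real.log (f₁ (X t ω) (X (t + 1) ω) / f₀ (X t ω) (X (t + 1) ω))

/-- `I` is the information rate of the change from `f₀` to `f₁`. Here `X ν` is the observed
process when the transitions `t → t + 1` follow `f₀` for `t < ν` and `f₁` for `t ≥ ν`, so that
`X ν (ν + 1)` is the first observation after the change. The normalized sums of the
log-likelihood ratios after the change converge a.s. to `I`, and, unless the rate vanishes, for
all `δ > 0` the essential supremum of the conditional probability
`P (max_{t ≤ n} ∑_{i = ν}^{ν + t} Z_i ≥ I (1 + δ) n | X₀, …, X_ν)` tends to `0` as `n → ∞`,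
uniformly in `ν`. -/
def IsInformationRate {S Ω : Type*} [MeasurableSpace S] [MeasurableSpace Ω] (P : Measure Ω)
    (f₀ f₁ : S → S → ℝ) (X : ℕ → ℕ → Ω → S) (I : ℝ) : Prop :=
  (∀ ν : ℕ, ∀ᵐ ω ∂P, Tendsto
    (fun n : ℕ => (n : ℝ)⁻¹ * ∑ t ∈ Finset.Icc ν (ν + n), logLikelihoodRatio f₀ f₁ (X ν) t ω)
    atTop (𝓝 I)) ∧
  (I ≠ 0 → ∀ δ : ℝ, 0 < δ → Tendsto
    (fun n : ℕ => ⨆ ν : ℕ, essSup (fun ω => ENNReal.ofReal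
      ((P⟦{ω' | ∃ t ≤ n, I * (1 + δ) * n ≤
          ∑ i ∈ Finset.Icc ν (ν + t), logLikelihoodRatio f₀ f₁ (X ν) i ω'} |
        ⨆ j ∈ Set.Iic ν, MeasurableSpace.comap (X ν j) inferInstance⟧) ω)) P)
    atTop (𝓝 0))

open Classical in
/-- The information rate (the inverse of the privacy level), `0` if there is none. -/
noncomputable def informationRate {S Ω : Type*} [MeasurableSpace S] [MeasurableSpace Ω]
    (P : Measure Ω) (f₀ f₁ : S → S → ℝ) (X : ℕ → ℕ → Ω → S) : ℝ :=
  if h : ∃ I, IsInformationRate P f₀ f₁ X I then h.choose else 0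

/-! ### The linear system -/

/-- The data of the system `x_{t+1} = A x_t + B u_t + F θ 1_{t ≥ ν} + w_t`, where `w` has
covariance `Q`, with feedback gain `K`. -/
structure LinearSystem (n m k : ℕ) where
  A : Matrix (Fin n) (Fin n) ℝ
  B : Matrix (Fin n) (Fin m) ℝ
  F : Matrix (Fin n) (Fin k) ℝ
  θ : Fin k → ℝ
  Q : Matrix (Fin n) (Fin n) ℝ
  K : Matrix (Fin m) (Fin n) ℝ

/-- All the complex eigenvalues lie in the open unit disc. -/
def IsSchur {n : ℕ} (M : Matrix (Fin n) (Fin n) ℝ) : Prop :=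
  ∀ z ∈ spectrum ℂ (M.map ((↑) : ℝ → ℂ)), ‖z‖ < 1

namespace LinearSystem

variable {n m k : ℕ} (S : LinearSystem n m k)

/-- The state under `u_t = K x_t + α₀` for `t < ν` and `u_t = K x_t + α₁` for `t ≥ ν`, from the
initial state `ξ`, with noise `w`. There is no change if `ν = ⊤`. -/
noncomputable def state {Ω : Type*} (ξ : Ω → (Fin n → ℝ)) (w : ℕ → Ω → (Fin n → ℝ))
    (α₀ α₁ : Fin m → ℝ) (ν : ℕ∞) : ℕ → Ω → (Fin n → ℝ)
  | 0, ω => ξ ω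
  | t + 1, ω =>
    let x := state ξ w α₀ α₁ ν t ω
    let u := S.K *ᵥ x + (if ν ≤ (t : ℕ∞) then α₁ else α₀)
    S.A *ᵥ x + S.B *ᵥ u + (if ν ≤ (t : ℕ∞) then S.F *ᵥ S.θ else 0) + w t ω

/-- The density `y ↦ f₀(y | x)` of the next state before the change. -/
noncomputable def densityBefore (α₀ : Fin m → ℝ) (x : Fin n → ℝ) : (Fin n → ℝ) → ℝ :=
  gaussianDensity (S.A *ᵥ x + S.B *ᵥ (S.K *ᵥ x + α₀)) S.Q

/-- The density `y ↦ f₁(y | x)` of the next state after the change. -/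
noncomputable def densityAfter (α₁ : Fin m → ℝ) (x : Fin n → ℝ) : (Fin n → ℝ) → ℝ :=
  gaussianDensity (S.A *ᵥ x + S.B *ᵥ (S.K *ᵥ x + α₁) + S.F *ᵥ S.θ) S.Q

/-- The information rate `I_L(α₀, α₁)` when the states, and only they, are observed. -/
noncomputable def limitedInformation {Ω : Type*} [MeasurableSpace Ω] (P : Measure Ω)
    (ξ : Ω → (Fin n → ℝ)) (w : ℕ → Ω → (Fin n → ℝ)) (α₀ α₁ : Fin m → ℝ) : ℝ :=
  informationRate P (S.densityBefore α₀) (S.densityAfter α₁)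
    (fun ν => S.state ξ w α₀ α₁ (ν : ℕ∞))

/-- The utility-privacy value `V_L(ρ, λ, α₀, α₁) = (1 - ρ) V₀ + ρ V₁ - λ I_L`, where `V₀` and `V₁`
are the ergodic rewards of the system that never changes and of the system that has changed from
the start. -/
noncomputable def utilityPrivacyValue {Ω : Type*} [MeasurableSpace Ω] (P : Measure Ω)
    (ξ : Ω → (Fin n → ℝ)) (w : ℕ → Ω → (Fin n → ℝ)) (ρ lam : ℝ) (α₀ α₁ : Fin m → ℝ) : ℝ :=
  (1 - ρ) * ergodicReward P (S.state ξ w α₀ α₁ ⊤) + ρ * ergodicReward P (S.state ξ w α₀ α₁ 0)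
    - lam * S.limitedInformation P ξ w α₀ α₁

/-- `E = (L⁻¹)ᵀ L⁻¹` with `L = 1 - A - B K`. -/
noncomputable def E : Matrix (Fin n) (Fin n) ℝ :=
  ((1 - S.A - S.B * S.K)⁻¹)ᵀ * (1 - S.A - S.B * S.K)⁻¹

/-- `B̃_T(M) = (Bᵀ (M + T) B)⁻¹ Bᵀ M`. -/
noncomputable def Btilde (T M : Matrix (Fin n) (Fin n) ℝ) : Matrix (Fin m) (Fin n) ℝ :=
  (S.Bᵀ * (M + T) * S.B)⁻¹ * S.Bᵀ * M

/-- `M(ρ, λ) = (1 - ρ) E B B̃_{2(1-ρ)E/λ}(Q⁻¹) + ρ E`. -/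
noncomputable def mixMatrix (ρ lam : ℝ) : Matrix (Fin n) (Fin n) ℝ :=
  (1 - ρ) • (S.E * S.B * S.Btilde ((2 * (1 - ρ) / lam) • S.E) S.Q⁻¹) + ρ • S.E

noncomputable def α₁Star (ρ lam : ℝ) : Fin m → ℝ :=
  -(S.Btilde 0 (S.mixMatrix ρ lam) *ᵥ (S.F *ᵥ S.θ))

noncomputable def α₀Star (ρ lam : ℝ) : Fin m → ℝ :=
  S.Btilde ((2 * (1 - ρ) / lam) • S.E) S.Q⁻¹ *ᵥ (S.F *ᵥ S.θ + S.B *ᵥ S.α₁Star ρ lam)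

end LinearSystem

theorem tendsto_pow_zero_of_spectralRadius_lt_one {A : Type*} [NormedRing A] [NormedAlgebra ℂ A]
    [CompleteSpace A] {a : A} (h : spectralRadius ℂ a < 1) :
    Tendsto (fun t : ℕ => a ^ t) atTop (𝓝 0) := by
  obtain ⟨r, hr1, hr2⟩ := ENNReal.lt_iff_exists_nnreal_btwn.1 h
  have hr2' : r < 1 := by exact_mod_cast hr2
  have hev := (spectrum.pow_nnnorm_pow_one_div_tendsto_nhds_spectralRadius a).eventually_lt_const hr1
  refine squeeze_zero_norm' ?_ (tendsto_pow_atTop_nhds_zero_of_lt_one r.2 hr2')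
  filter_upwards [hev, eventually_gt_atTop 0] with t ht ht0
  have h1 : ((‖a ^ t‖₊ : ENNReal) ^ (1 / (t : ℝ))) ^ (t : ℝ) ≤ (r : ENNReal) ^ (t : ℝ) :=
    ENNReal.rpow_le_rpow ht.le (by positivity)
  rw [← ENNReal.rpow_mul, one_div, inv_mul_cancel₀ (by positivity), ENNReal.rpow_one,
    ENNReal.rpow_natCast, ← ENNReal.coe_pow, ENNReal.coe_le_coe] at h1
  exact_mod_cast h1

theorem tendsto_matrix_pow_zero {n : ℕ} {M : Matrix (Fin n) (Fin n) ℂ}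
    (h : ∀ z ∈ spectrum ℂ M, ‖z‖ < 1) : Tendsto (fun t : ℕ => M ^ t) atTop (𝓝 0) := by
  rcases Nat.eq_zero_or_pos n with rfl | hn
  · exact tendsto_const_nhds.congr fun t => Subsingleton.elim _ _
  · have : Nonempty (Fin n) := ⟨⟨0, hn⟩⟩
    let _ := Matrix.linftyOpNormedRing (n := Fin n) (α := ℂ)
    let _ := Matrix.linftyOpNormedAlgebra (n := Fin n) (R := ℂ) (α := ℂ)
    have : CompleteSpace (Matrix (Fin n) (Fin n) ℂ) := FiniteDimensional.complete ℂ _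
    exact tendsto_pow_zero_of_spectralRadius_lt_one
      (spectrum.spectralRadius_lt_of_forall_lt M (r := 1) fun z hz => by exact_mod_cast h z hz)

namespace IsSchur

variable {n : ℕ} {M : Matrix (Fin n) (Fin n) ℝ}

theorem tendsto_pow (h : IsSchur M) : Tendsto (fun t : ℕ => M ^ t) atTop (𝓝 0) := by
  have h1 := tendsto_matrix_pow_zero h
  refine tendsto_pi_nhds.2 fun i => tendsto_pi_nhds.2 fun j => ?_
  have h2 := tendsto_pi_nhds.1 (tendsto_pi_nhds.1 h1 i) j
  have h3 : ∀ t : ℕ, ((M ^ t) i j : ℂ) = (M.map ((↑) : ℝ → ℂ) ^ t) i j := fun t =>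
    congrFun (congrFun (Matrix.map_pow M Complex.ofRealHom t) i) j
  simp only [← h3] at h2
  exact (Complex.continuous_re.tendsto _).comp h2

theorem tendsto_pow_mul_mul_pow (h : IsSchur M) (X : Matrix (Fin n) (Fin n) ℝ) :
    Tendsto (fun t : ℕ => M ^ t * X * (M ^ t)ᵀ) atTop (𝓝 0) := by
  have h2 : Tendsto (fun t : ℕ => (M ^ t)ᵀ) atTop (𝓝 0) :=
    (continuous_id.matrix_transpose.tendsto' 0 0 Matrix.transpose_zero).comp h.tendsto_pow
  simpa using (h.tendsto_pow.mul tendsto_const_nhds).mul h2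

theorem eq_zero_of_eq_conj (h : IsSchur M) {X : Matrix (Fin n) (Fin n) ℝ}
    (hX : X = M * X * Mᵀ) : X = 0 := by
  have h1 : ∀ t : ℕ, M ^ t * X * (M ^ t)ᵀ = X := by
    intro t
    induction t with
    | zero => simp
    | succ t ih =>
      rw [pow_succ, Matrix.transpose_mul]
      calc M ^ t * M * X * (Mᵀ * (M ^ t)ᵀ) = M ^ t * (M * X * Mᵀ) * (M ^ t)ᵀ := by
            simp only [Matrix.mul_assoc]
        _ = X := by rw [← hX, ih]
  exact tendsto_nhds_unique (tendsto_const_nhds.congr fun t => (h1 t).symm)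
    (h.tendsto_pow_mul_mul_pow X)

theorem existsUnique_lyapunov (h : IsSchur M) (Q : Matrix (Fin n) (Fin n) ℝ) :
    ∃! X : Matrix (Fin n) (Fin n) ℝ, X = M * X * Mᵀ + Q := by
  let T : Matrix (Fin n) (Fin n) ℝ →ₗ[ℝ] Matrix (Fin n) (Fin n) ℝ :=
    LinearMap.id - (LinearMap.mulRight ℝ Mᵀ).comp (LinearMap.mulLeft ℝ M)
  have hT : ∀ X, T X = X - M * X * Mᵀ := fun X => rfl
  have hinj : Function.Injective T := by
    refine (injective_iff_map_eq_zero T).2 fun X hX => h.eq_zero_of_eq_conj ?_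
    rwa [hT, sub_eq_zero] at hX
  obtain ⟨X, hX⟩ := LinearMap.injective_iff_surjective.1 hinj Q
  refine ⟨X, ?_, fun Y hY => hinj ?_⟩
  · rw [← hX, hT]; simp
  · rw [hX, hT]; exact sub_eq_of_eq_add' hY

theorem isUnit_one_sub (h : IsSchur M) : IsUnit (1 - M) := by
  rw [← Matrix.mulVec_injective_iff_isUnit]
  refine (injective_iff_map_eq_zero (Matrix.mulVecLin (1 - M))).2 fun v hv => ?_
  have hv1 : v = M *ᵥ v := by
    rw [Matrix.mulVecLin_apply, Matrix.sub_mulVec, Matrix.one_mulVec] at hv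
    exact sub_eq_zero.1 hv
  have h1 : ∀ t : ℕ, M ^ t *ᵥ v = v := by
    intro t
    induction t with
    | zero => simp
    | succ t ih => rw [pow_succ, ← Matrix.mulVec_mulVec, ← hv1, ih]
  have h2 : Tendsto (fun t : ℕ => M ^ t *ᵥ v) atTop (𝓝 (0 *ᵥ v)) :=
    ((continuous_id.matrix_mulVec continuous_const).tendsto 0).comp h.tendsto_pow
  rw [Matrix.zero_mulVec] at h2
  exact tendsto_nhds_unique (tendsto_const_nhds.congr fun t => (h1 t).symm) h2

end IsSchur

namespace Matrix

variable {n m : ℕ}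

theorem dotProduct_mulVec_add_add {R : Matrix (Fin n) (Fin n) ℝ} (hR : R.IsHermitian)
    (x y : Fin n → ℝ) :
    (x + y) ⬝ᵥ R *ᵥ (x + y) = x ⬝ᵥ R *ᵥ x + 2 * (y ⬝ᵥ R *ᵥ x) + y ⬝ᵥ R *ᵥ y := by
  have h : x ⬝ᵥ R *ᵥ y = y ⬝ᵥ R *ᵥ x := by
    have hT : Rᵀ = R := by simpa using hR.eq
    rw [dotProduct_mulVec, ← mulVec_transpose, hT, dotProduct_comm]
  rw [mulVec_add, add_dotProduct, dotProduct_add, dotProduct_add, h]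
  ring

theorem PosDef.dotProduct_mulVec_nonneg' {R : Matrix (Fin n) (Fin n) ℝ} (hR : R.PosDef)
    (x : Fin n → ℝ) : 0 ≤ x ⬝ᵥ R *ᵥ x := by
  simpa using hR.posSemidef.dotProduct_mulVec_nonneg x

theorem PosDef.eq_zero_of_dotProduct_mulVec_nonpos {R : Matrix (Fin n) (Fin n) ℝ} (hR : R.PosDef)
    {x : Fin n → ℝ} (h : x ⬝ᵥ R *ᵥ x ≤ 0) : x = 0 := by
  by_contra hx
  have := hR.dotProduct_mulVec_pos hx
  simp only [star_trivial] at this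
  linarith

theorem mulVec_dotProduct_eq (B : Matrix (Fin n) (Fin m) ℝ) (h : Fin m → ℝ) (v : Fin n → ℝ) :
    (B *ᵥ h) ⬝ᵥ v = h ⬝ᵥ Bᵀ *ᵥ v := by
  rw [dotProduct_comm, dotProduct_mulVec, ← mulVec_transpose, dotProduct_comm]

theorem PosDef.isUnit_transpose_mul_mul {R : Matrix (Fin n) (Fin n) ℝ} (hR : R.PosDef)
    {B : Matrix (Fin n) (Fin m) ℝ} (hB : Function.Injective B.mulVec) : IsUnit (Bᵀ * R * B) := by
  simpa using (hR.conjTranspose_mul_mul_same hB).isUnit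

end Matrix

/-- The loss `-V_L - Tr Σ` as a function of the two inputs. -/
noncomputable def inputLoss {n m : ℕ} (B : Matrix (Fin n) (Fin m) ℝ)
    (E R : Matrix (Fin n) (Fin n) ℝ) (f : Fin n → ℝ) (ρ lam : ℝ) (α₀ α₁ : Fin m → ℝ) : ℝ :=
  (1 - ρ) * ((B *ᵥ α₀) ⬝ᵥ E *ᵥ (B *ᵥ α₀)) + ρ * ((B *ᵥ α₁ + f) ⬝ᵥ E *ᵥ (B *ᵥ α₁ + f)) +
    lam * (1 / 2) * ((f + B *ᵥ (α₁ - α₀)) ⬝ᵥ R *ᵥ (f + B *ᵥ (α₁ - α₀)))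

section inputLoss

variable {n m : ℕ} {B : Matrix (Fin n) (Fin m) ℝ} {E R : Matrix (Fin n) (Fin n) ℝ}
  {f : Fin n → ℝ} {ρ lam : ℝ} {α₀ α₁ : Fin m → ℝ}

theorem inputLoss_add (hE : E.PosDef) (hR : R.PosDef)
    (h0 : (1 - ρ) • Bᵀ *ᵥ (E *ᵥ (B *ᵥ α₀)) =
      (lam * (1 / 2)) • Bᵀ *ᵥ (R *ᵥ (f + B *ᵥ (α₁ - α₀))))
    (h1 : ρ • Bᵀ *ᵥ (E *ᵥ (B *ᵥ α₁ + f)) + (1 - ρ) • Bᵀ *ᵥ (E *ᵥ (B *ᵥ α₀)) = 0)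
    (k₀ k₁ : Fin m → ℝ) :
    inputLoss B E R f ρ lam (α₀ + k₀) (α₁ + k₁) =
      inputLoss B E R f ρ lam α₀ α₁ + inputLoss B E R 0 ρ lam k₀ k₁ := by
  have e1 : B *ᵥ (α₁ + k₁) + f = (B *ᵥ α₁ + f) + B *ᵥ k₁ := by rw [mulVec_add]; abel
  have e2 : f + B *ᵥ (α₁ + k₁ - (α₀ + k₀)) = (f + B *ᵥ (α₁ - α₀)) + B *ᵥ (k₁ - k₀) := by
    rw [add_sub_add_comm, mulVec_add]; abel
  have h0' := congrArg (fun v => (k₁ - k₀) ⬝ᵥ v) h0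
  have h1' := congrArg (fun v => k₁ ⬝ᵥ v) h1
  simp only [dotProduct_add, dotProduct_smul, smul_eq_mul, dotProduct_zero, sub_dotProduct]
    at h0' h1'
  unfold inputLoss
  rw [e1, e2, mulVec_add B α₀ k₀, dotProduct_mulVec_add_add hE.isHermitian,
    dotProduct_mulVec_add_add hE.isHermitian, dotProduct_mulVec_add_add hR.isHermitian]
  simp only [mulVec_dotProduct_eq, add_zero, zero_add, sub_dotProduct] at *
  linear_combination (-2) * h0' + 2 * h1'

theorem eq_zero_of_inputLoss_nonpos (hE : E.PosDef) (hR : R.PosDef)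
    (hB : Function.Injective B.mulVec) (hρ : ρ ∈ Set.Icc (0 : ℝ) 1) (hlam : 0 < lam)
    (h : inputLoss B E R 0 ρ lam α₀ α₁ ≤ 0) : α₀ = 0 ∧ α₁ = 0 := by
  simp only [inputLoss, add_zero, zero_add] at h
  have n0 := mul_nonneg (sub_nonneg.2 hρ.2) (hE.dotProduct_mulVec_nonneg' (B *ᵥ α₀))
  have n1 := mul_nonneg hρ.1 (hE.dotProduct_mulVec_nonneg' (B *ᵥ α₁))
  have n2 := hR.dotProduct_mulVec_nonneg' (B *ᵥ (α₁ - α₀))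
  have hB0 : ∀ v, B *ᵥ v = 0 → v = 0 := fun v hv => hB (by rw [hv, mulVec_zero])
  have h2 : (B *ᵥ (α₁ - α₀)) ⬝ᵥ R *ᵥ (B *ᵥ (α₁ - α₀)) ≤ 0 := by
    by_contra! hpos
    have := mul_pos (mul_pos hlam one_half_pos) hpos
    linarith
  have h3 : α₁ = α₀ := sub_eq_zero.1 (hB0 _ (hR.eq_zero_of_dotProduct_mulVec_nonpos h2))
  subst h3
  have n3 := mul_nonneg (mul_pos hlam one_half_pos).le n2
  have h4 : α₁ = 0 := hB0 _ (hE.eq_zero_of_dotProduct_mulVec_nonpos (by linarith))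
  exact ⟨h4, h4⟩

theorem forall_inputLoss_le_iff (hE : E.PosDef) (hR : R.PosDef)
    (hB : Function.Injective B.mulVec) (hρ : ρ ∈ Set.Icc (0 : ℝ) 1) (hlam : 0 < lam)
    (h0 : (1 - ρ) • Bᵀ *ᵥ (E *ᵥ (B *ᵥ α₀)) =
      (lam * (1 / 2)) • Bᵀ *ᵥ (R *ᵥ (f + B *ᵥ (α₁ - α₀))))
    (h1 : ρ • Bᵀ *ᵥ (E *ᵥ (B *ᵥ α₁ + f)) + (1 - ρ) • Bᵀ *ᵥ (E *ᵥ (B *ᵥ α₀)) = 0)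
    (β₀ β₁ : Fin m → ℝ) :
    (∀ γ₀ γ₁, inputLoss B E R f ρ lam β₀ β₁ ≤ inputLoss B E R f ρ lam γ₀ γ₁) ↔
      β₀ = α₀ ∧ β₁ = α₁ := by
  have key : ∀ γ₀ γ₁, inputLoss B E R f ρ lam γ₀ γ₁ = inputLoss B E R f ρ lam α₀ α₁ +
      inputLoss B E R 0 ρ lam (γ₀ - α₀) (γ₁ - α₁) := fun γ₀ γ₁ => by
    rw [← inputLoss_add hE hR h0 h1, add_sub_cancel, add_sub_cancel]
  constructor
  · intro h
    have := h α₀ α₁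
    rw [key β₀ β₁] at this
    obtain ⟨h2, h3⟩ := eq_zero_of_inputLoss_nonpos hE hR hB hρ hlam (by linarith :
      inputLoss B E R 0 ρ lam (β₀ - α₀) (β₁ - α₁) ≤ 0)
    exact ⟨sub_eq_zero.1 h2, sub_eq_zero.1 h3⟩
  · rintro ⟨rfl, rfl⟩ γ₀ γ₁
    rw [key γ₀ γ₁]
    by_contra! hlt
    obtain ⟨h2, h3⟩ := eq_zero_of_inputLoss_nonpos hE hR hB hρ hlam (by linarith :
      inputLoss B E R 0 ρ lam (γ₀ - β₀) (γ₁ - β₁) ≤ 0)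
    rw [h2, h3] at hlt
    simp [inputLoss] at hlt

theorem forall_quadratic_le_iff (hR : R.PosDef) (hB : Function.Injective B.mulVec)
    (h1 : Bᵀ *ᵥ (R *ᵥ (B *ᵥ α₁ + f)) = 0) (β : Fin m → ℝ) :
    (∀ γ : Fin m → ℝ, (B *ᵥ β + f) ⬝ᵥ R *ᵥ (B *ᵥ β + f) ≤ (B *ᵥ γ + f) ⬝ᵥ R *ᵥ (B *ᵥ γ + f)) ↔
      β = α₁ := by
  have key : ∀ γ : Fin m → ℝ, (B *ᵥ γ + f) ⬝ᵥ R *ᵥ (B *ᵥ γ + f) =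
      (B *ᵥ α₁ + f) ⬝ᵥ R *ᵥ (B *ᵥ α₁ + f) + (B *ᵥ (γ - α₁)) ⬝ᵥ R *ᵥ (B *ᵥ (γ - α₁)) := by
    intro γ
    have e1 : B *ᵥ γ + f = (B *ᵥ α₁ + f) + B *ᵥ (γ - α₁) := by rw [mulVec_sub]; abel
    rw [e1, dotProduct_mulVec_add_add hR.isHermitian, mulVec_dotProduct_eq B (γ - α₁) (R *ᵥ _),
      h1, dotProduct_zero, mul_zero, add_zero]
  constructor
  · intro h
    have := h α₁
    rw [key β] at this
    have h2 := hR.eq_zero_of_dotProduct_mulVec_nonpos (x := B *ᵥ (β - α₁)) (by linarith)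
    exact sub_eq_zero.1 (hB (by rw [h2, mulVec_zero]))
  · rintro rfl γ
    rw [key γ]
    linarith [hR.dotProduct_mulVec_nonneg' (B *ᵥ (γ - β))]

end inputLoss

namespace LinearSystem

variable {n m k : ℕ} (S : LinearSystem n m k)

theorem posDef_E (hK : IsSchur (S.A + S.B * S.K)) : S.E.PosDef := by
  have hL : IsUnit (1 - S.A - S.B * S.K) := by
    rw [sub_sub]; exact hK.isUnit_one_sub
  have h : ((1 - S.A - S.B * S.K)⁻¹ᴴ * (1 - S.A - S.B * S.K)⁻¹).PosDef :=
    Matrix.PosDef.conjTranspose_mul_self _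
      (Matrix.mulVec_injective_iff_isUnit.2 ((Matrix.isUnit_nonsing_inv_iff).2 hL))
  simpa [E] using h

theorem transpose_mulVec_Btilde {T N : Matrix (Fin n) (Fin n) ℝ}
    (h : IsUnit (S.Bᵀ * (N + T) * S.B)) (x : Fin n → ℝ) :
    S.Bᵀ *ᵥ ((N + T) *ᵥ (S.B *ᵥ (S.Btilde T N *ᵥ x))) = S.Bᵀ *ᵥ (N *ᵥ x) := by
  have e : S.Bᵀ * (N + T) * S.B * S.Btilde T N = S.Bᵀ * N := by
    rw [Btilde, Matrix.mul_assoc _ S.Bᵀ, Matrix.mul_nonsing_inv_cancel_left _ _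
      ((Matrix.isUnit_iff_isUnit_det _).1 h)]
  simp only [mulVec_mulVec, ← Matrix.mul_assoc, e]

theorem Btilde_mul_B_mul_Btilde_zero {T N : Matrix (Fin n) (Fin n) ℝ}
    (h : IsUnit (S.Bᵀ * N * S.B)) : S.Btilde T N * S.B * S.Btilde 0 N = S.Btilde T N := by
  have e : S.Bᵀ * N * S.B * S.Btilde 0 N = S.Bᵀ * N := by
    rw [Btilde, add_zero, Matrix.mul_assoc _ S.Bᵀ, Matrix.mul_nonsing_inv_cancel_left _ _
      ((Matrix.isUnit_iff_isUnit_det _).1 h)]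
  calc _ = (S.Bᵀ * (N + T) * S.B)⁻¹ * (S.Bᵀ * N * S.B * S.Btilde 0 N) := by
        rw [Btilde.eq_def S T N]; simp only [Matrix.mul_assoc]
    _ = _ := by rw [e, Btilde.eq_def S T N, Matrix.mul_assoc _ S.Bᵀ]

variable {S} {ρ lam : ℝ}

theorem isUnit_posDef_weight (hQ : S.Q.PosDef) (hB : Function.Injective S.B.mulVec)
    (hK : IsSchur (S.A + S.B * S.K)) (hρ : ρ ≤ 1) (hlam : 0 < lam) :
    IsUnit (S.Bᵀ * (S.Q⁻¹ + (2 * (1 - ρ) / lam) • S.E) * S.B) :=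
  (hQ.inv.add_posSemidef ((S.posDef_E hK).posSemidef.smul (by
    have := sub_nonneg.2 hρ; positivity))).isUnit_transpose_mul_mul hB

/-- The first first-order condition holds for the optimal response `α₀` to a shift `x`. -/
theorem firstOrder_Btilde (hlam : 0 < lam)
    (h : IsUnit (S.Bᵀ * (S.Q⁻¹ + (2 * (1 - ρ) / lam) • S.E) * S.B)) (x : Fin n → ℝ) :
    (1 - ρ) • S.Bᵀ *ᵥ (S.E *ᵥ (S.B *ᵥ (S.Btilde ((2 * (1 - ρ) / lam) • S.E) S.Q⁻¹ *ᵥ x))) =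
      (lam * (1 / 2)) • S.Bᵀ *ᵥ (S.Q⁻¹ *ᵥ
        (x - S.B *ᵥ (S.Btilde ((2 * (1 - ρ) / lam) • S.E) S.Q⁻¹ *ᵥ x))) := by
  have e := S.transpose_mulVec_Btilde h x
  rw [add_mulVec, smul_mulVec, mulVec_add, mulVec_smul] at e
  rw [mulVec_sub, mulVec_sub, ← e, add_sub_cancel_left, smul_smul]
  congr 1
  field_simp

theorem transpose_mulVec_mixMatrix (x : Fin n → ℝ) :
    S.Bᵀ *ᵥ (S.mixMatrix ρ lam *ᵥ x) = ρ • S.Bᵀ *ᵥ (S.E *ᵥ x) + (1 - ρ) • S.Bᵀ *ᵥ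
      (S.E *ᵥ (S.B *ᵥ (S.Btilde ((2 * (1 - ρ) / lam) • S.E) S.Q⁻¹ *ᵥ x))) := by
  rw [mixMatrix, add_mulVec, smul_mulVec, smul_mulVec, mulVec_add, mulVec_smul, mulVec_smul,
    ← mulVec_mulVec, ← mulVec_mulVec, add_comm]

theorem isUnit_mixMatrix (hQ : S.Q.PosDef) (hB : Function.Injective S.B.mulVec)
    (hK : IsSchur (S.A + S.B * S.K)) (hρ : ρ ∈ Set.Icc (0 : ℝ) 1) (hlam : 0 < lam) :
    IsUnit (S.Bᵀ * S.mixMatrix ρ lam * S.B) := by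
  rw [← Matrix.mulVec_injective_iff_isUnit]
  refine (injective_iff_map_eq_zero (Matrix.mulVecLin _)).2 fun x hx => ?_
  rw [mulVecLin_apply, ← mulVec_mulVec, ← mulVec_mulVec, transpose_mulVec_mixMatrix] at hx
  have h0 := firstOrder_Btilde hlam (isUnit_posDef_weight hQ hB hK hρ.2 hlam) (S.B *ᵥ x)
  set y := S.Btilde ((2 * (1 - ρ) / lam) • S.E) S.Q⁻¹ *ᵥ (S.B *ᵥ x)
  have h := inputLoss_add (f := 0) (ρ := ρ) (lam := lam) (α₀ := y) (α₁ := x) (S.posDef_E hK) hQ.inv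
    (by rw [h0, zero_add, ← mulVec_sub S.B]) (by rw [add_zero, hx]) (-y) (-x)
  have h2 : inputLoss S.B S.E S.Q⁻¹ 0 ρ lam (-y) (-x) = inputLoss S.B S.E S.Q⁻¹ 0 ρ lam y x := by
    simp only [inputLoss, mulVec_neg, add_zero, zero_add, neg_dotProduct_neg,
      sub_neg_eq_add]
    rw [neg_add_eq_sub, ← neg_sub x y, mulVec_neg, mulVec_neg, neg_dotProduct_neg]
  have h3 : inputLoss S.B S.E S.Q⁻¹ 0 ρ lam 0 (0 : Fin m → ℝ) = 0 := by simp [inputLoss]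
  rw [add_neg_cancel, add_neg_cancel, h2, h3] at h
  have h4 : inputLoss S.B S.E S.Q⁻¹ 0 ρ lam y x ≤ 0 := by linarith
  exact (eq_zero_of_inputLoss_nonpos (S.posDef_E hK) hQ.inv hB hρ hlam h4).2

theorem forall_inputLoss_le_iff_star (hQ : S.Q.PosDef) (hB : Function.Injective S.B.mulVec)
    (hK : IsSchur (S.A + S.B * S.K)) (hρ : ρ ∈ Set.Icc (0 : ℝ) 1) (hlam : 0 < lam)
    (β₀ β₁ : Fin m → ℝ) :
    (∀ γ₀ γ₁, inputLoss S.B S.E S.Q⁻¹ (S.F *ᵥ S.θ) ρ lam β₀ β₁ ≤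
      inputLoss S.B S.E S.Q⁻¹ (S.F *ᵥ S.θ) ρ lam γ₀ γ₁) ↔
      β₀ = S.α₀Star ρ lam ∧ β₁ = S.α₁Star ρ lam := by
  refine forall_inputLoss_le_iff (S.posDef_E hK) hQ.inv hB hρ hlam ?_ ?_ β₀ β₁
  · have h0 := firstOrder_Btilde hlam (isUnit_posDef_weight hQ hB hK hρ.2 hlam)
      (S.F *ᵥ S.θ + S.B *ᵥ S.α₁Star ρ lam)
    rw [mulVec_sub, ← add_sub_assoc]
    exact h0
  · have h := S.transpose_mulVec_Btilde (T := 0) (N := S.mixMatrix ρ lam)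
      (by rw [add_zero]; exact isUnit_mixMatrix hQ hB hK hρ hlam) (S.F *ᵥ S.θ)
    have h1 : S.Bᵀ *ᵥ (S.mixMatrix ρ lam *ᵥ (S.B *ᵥ S.α₁Star ρ lam + S.F *ᵥ S.θ)) = 0 := by
      rw [mulVec_add, mulVec_add, ← h, α₁Star, add_zero, mulVec_neg, mulVec_neg, mulVec_neg,
        neg_add_cancel]
    rw [transpose_mulVec_mixMatrix] at h1
    rw [α₀Star, add_comm (S.F *ᵥ S.θ)]
    exact h1

theorem α₁Star_zero (hQ : S.Q.PosDef) (hB : Function.Injective S.B.mulVec)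
    (hK : IsSchur (S.A + S.B * S.K)) (hlam : 0 < lam) :
    S.α₁Star 0 lam = -(S.Btilde 0 S.Q⁻¹ *ᵥ (S.F *ᵥ S.θ)) := by
  have hu := isUnit_mixMatrix (ρ := 0) hQ hB hK (by simp) hlam
  have e : S.Bᵀ * S.mixMatrix 0 lam * S.B * S.Btilde 0 S.Q⁻¹ = S.Bᵀ * S.mixMatrix 0 lam := by
    simp only [mixMatrix, sub_zero, one_smul, zero_smul, add_zero]
    conv_rhs => rw [← S.Btilde_mul_B_mul_Btilde_zero (hQ.inv.isUnit_transpose_mul_mul hB)]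
    simp only [Matrix.mul_assoc]
  have e' : S.Btilde 0 (S.mixMatrix 0 lam) = S.Btilde 0 S.Q⁻¹ := by
    rw [Btilde.eq_def S 0 (S.mixMatrix 0 lam), add_zero, Matrix.mul_assoc _ S.Bᵀ]
    have h := Matrix.nonsing_inv_mul_cancel_left (S.Bᵀ * S.mixMatrix 0 lam * S.B) (S.Btilde 0 S.Q⁻¹)
      ((Matrix.isUnit_iff_isUnit_det _).1 hu)
    rwa [e] at h
  rw [α₁Star, e']

theorem α₀Star_zero (hQ : S.Q.PosDef) (hB : Function.Injective S.B.mulVec)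
    (hK : IsSchur (S.A + S.B * S.K)) (hlam : 0 < lam) : S.α₀Star 0 lam = 0 := by
  rw [α₀Star, α₁Star_zero hQ hB hK hlam, mulVec_add, mulVec_neg, mulVec_neg,
    mulVec_mulVec (S.F *ᵥ S.θ), mulVec_mulVec (S.F *ᵥ S.θ), ← Matrix.mul_assoc, S.Btilde_mul_B_mul_Btilde_zero
      (hQ.inv.isUnit_transpose_mul_mul hB), add_neg_cancel]

theorem α₁Star_one : S.α₁Star 1 lam = -(S.Btilde 0 S.E *ᵥ (S.F *ᵥ S.θ)) := by
  simp [α₁Star, mixMatrix]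

theorem α₀Star_one : S.α₀Star 1 lam =
    S.Btilde 0 S.Q⁻¹ *ᵥ ((1 - S.B * S.Btilde 0 S.E) *ᵥ (S.F *ᵥ S.θ)) := by
  rw [α₀Star, α₁Star_one, sub_mulVec, one_mulVec, ← mulVec_mulVec, mulVec_neg, ← sub_eq_add_neg]
  simp

theorem forall_inputLoss_one_le_iff (hQ : S.Q.PosDef) (hB : Function.Injective S.B.mulVec)
    (hK : IsSchur (S.A + S.B * S.K)) (hlam : 0 < lam) (β : Fin m → ℝ) :
    (∀ γ, inputLoss S.B S.E S.Q⁻¹ (S.F *ᵥ S.θ) 1 lam 0 β ≤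
      inputLoss S.B S.E S.Q⁻¹ (S.F *ᵥ S.θ) 1 lam 0 γ) ↔
      β = -(S.Btilde 0 ((2 / lam) • S.E + S.Q⁻¹) *ᵥ (S.F *ᵥ S.θ)) := by
  have hN : ((2 / lam) • S.E + S.Q⁻¹).PosDef :=
    ((S.posDef_E hK).smul (by positivity)).add hQ.inv
  have e : ∀ γ, inputLoss S.B S.E S.Q⁻¹ (S.F *ᵥ S.θ) 1 lam 0 γ = lam * (1 / 2) *
      ((S.B *ᵥ γ + S.F *ᵥ S.θ) ⬝ᵥ ((2 / lam) • S.E + S.Q⁻¹) *ᵥ (S.B *ᵥ γ + S.F *ᵥ S.θ)) := by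
    intro γ
    rw [inputLoss, sub_zero, add_comm (S.F *ᵥ S.θ), add_mulVec, smul_mulVec, dotProduct_add,
      dotProduct_smul, smul_eq_mul]
    field_simp
    ring
  have h := S.transpose_mulVec_Btilde (T := 0) (N := (2 / lam) • S.E + S.Q⁻¹)
      (by rw [add_zero]; exact hN.isUnit_transpose_mul_mul hB) (S.F *ᵥ S.θ)
  rw [← forall_quadratic_le_iff hN hB (f := S.F *ᵥ S.θ) (by
    rw [mulVec_add, mulVec_add, ← h, add_zero, mulVec_neg, mulVec_neg, mulVec_neg,
        neg_add_cancel])]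
  refine forall_congr' fun γ => ?_
  rw [e, e, mul_le_mul_iff_right₀ (by positivity)]

end LinearSystem

theorem MeasurableSpace.sup_eq_generateFrom_image2_inter {Ω : Type*} (m₁ m₂ : MeasurableSpace Ω) :
    m₁ ⊔ m₂ = generateFrom (Set.image2 (· ∩ ·) {s | MeasurableSet[m₁] s}
      {s | MeasurableSet[m₂] s}) := by
  apply le_antisymm
  · refine sup_le (fun s hs => ?_) (fun s hs => ?_)
    · exact measurableSet_generateFrom ⟨s, hs, Set.univ, MeasurableSet.univ, Set.inter_univ s⟩
    · exact measurableSet_generateFrom ⟨Set.univ, MeasurableSet.univ, s, hs, Set.univ_inter s⟩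
  · refine generateFrom_le ?_
    rintro _ ⟨s, hs, t, ht, rfl⟩
    exact MeasurableSet.inter ((le_sup_left : m₁ ≤ m₁ ⊔ m₂) s hs)
      ((le_sup_right : m₂ ≤ m₁ ⊔ m₂) t ht)

theorem ProbabilityTheory.Indep.sup_left_of_sup_right {Ω : Type*} {m₁ m₂ m₃ mΩ : MeasurableSpace Ω}
    {P : Measure Ω} [IsProbabilityMeasure P] (h₁ : m₁ ≤ mΩ) (h₂ : m₂ ≤ mΩ) (h₃ : m₃ ≤ mΩ)
    (h : Indep m₁ (m₂ ⊔ m₃) P) (h' : Indep m₂ m₃ P) : Indep (m₁ ⊔ m₂) m₃ P := by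
  refine IndepSets.indep (sup_le h₁ h₂) h₃ ?_ (@MeasurableSpace.isPiSystem_measurableSet Ω m₃)
    (MeasurableSpace.sup_eq_generateFrom_image2_inter m₁ m₂)
    (@MeasurableSpace.generateFrom_measurableSet Ω m₃).symm ?_
  · rintro _ ⟨s, hs, t, ht, rfl⟩ _ ⟨s', hs', t', ht', rfl⟩ -
    exact ⟨s ∩ s', MeasurableSet.inter hs hs', t ∩ t', MeasurableSet.inter ht ht',
      Set.inter_inter_inter_comm s s' t t'⟩
  · rw [IndepSets_iff]
    rintro _ u ⟨s, hs, t, ht, rfl⟩ hu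
    have ht' : MeasurableSet[m₂ ⊔ m₃] t := (le_sup_left : m₂ ≤ m₂ ⊔ m₃) t ht
    have hu' : MeasurableSet[m₂ ⊔ m₃] u := (le_sup_right : m₃ ≤ m₂ ⊔ m₃) u hu
    have e := (Indep_iff _ _ P).1 h
    rw [Set.inter_assoc, e s _ hs (ht'.inter hu'), (Indep_iff _ _ P).1 h' t u ht hu, e s t hs ht',
      mul_assoc]

section Noise

variable {Ω β γ : Type*} [MeasurableSpace β] [MeasurableSpace γ]

/-- The σ-algebra of the initial state and of the noise before time `t`. -/
@[reducible] def pastSigma (ξ : Ω → β) (w : ℕ → Ω → γ) (t : ℕ) : MeasurableSpace Ω :=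
  MeasurableSpace.comap ξ inferInstance ⊔
    ⨆ j ∈ Set.Iio t, MeasurableSpace.comap (w j) inferInstance

theorem pastSigma_mono (ξ : Ω → β) (w : ℕ → Ω → γ) : Monotone (pastSigma ξ w) := fun _ _ h =>
  sup_le_sup_left (biSup_mono fun _ hj => lt_of_lt_of_le hj h) _

theorem measurable_pastSigma_initial (ξ : Ω → β) (w : ℕ → Ω → γ) (t : ℕ) :
    Measurable[pastSigma ξ w t] ξ :=
  (comap_measurable ξ).mono le_sup_left le_rfl

theorem measurable_pastSigma_noise (ξ : Ω → β) (w : ℕ → Ω → γ) (t : ℕ) :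
    Measurable[pastSigma ξ w (t + 1)] (w t) :=
  (comap_measurable (w t)).mono
    ((le_biSup (fun j => MeasurableSpace.comap (w j) inferInstance)
      (Set.mem_Iio.2 t.lt_succ_self)).trans le_sup_right) le_rfl

theorem indep_pastSigma [MeasurableSpace Ω] {P : Measure Ω} [IsProbabilityMeasure P] {ξ : Ω → β} {w : ℕ → Ω → γ}
    (hξ : Measurable ξ) (hw : ∀ t, Measurable (w t)) (hwind : iIndepFun w P)
    (hξw : IndepFun ξ (fun ω t => w t ω) P) (t : ℕ) :
    Indep (pastSigma ξ w t) (⨆ j ∈ Set.Ici t, MeasurableSpace.comap (w j) inferInstance) P := by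
  have hle : ∀ j, MeasurableSpace.comap (w j) inferInstance ≤ (inferInstance : MeasurableSpace Ω) :=
    fun j => (hw j).comap_le
  refine Indep.sup_left_of_sup_right hξ.comap_le (iSup₂_le fun j _ => hle j)
    (iSup₂_le fun j _ => hle j) ?_ (indep_iSup_of_disjoint hle hwind ?_)
  · refine indep_of_indep_of_le_right hξw ?_
    have h : ∀ j, MeasurableSpace.comap (w j) inferInstance ≤
        MeasurableSpace.comap (fun ω t => w t ω) inferInstance := fun j =>
      ((measurable_pi_apply j).comp (comap_measurable (fun ω t => w t ω))).comap_le
    exact sup_le (iSup₂_le fun j _ => h j) (iSup₂_le fun j _ => h j)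
  · exact Set.disjoint_left.2 fun j hj hj' => absurd (Set.mem_Iio.1 hj) (not_lt.2 hj')

theorem indepFun_of_measurable_pastSigma [MeasurableSpace Ω] {P : Measure Ω} [IsProbabilityMeasure P] {ξ : Ω → β}
    {w : ℕ → Ω → γ} (hξ : Measurable ξ) (hw : ∀ t, Measurable (w t)) (hwind : iIndepFun w P)
    (hξw : IndepFun ξ (fun ω t => w t ω) P) {t : ℕ} {δ : Type*} [MeasurableSpace δ] {Y : Ω → δ}
    (hY : Measurable[pastSigma ξ w t] Y) : IndepFun Y (w t) P :=
  indep_of_indep_of_le (indep_pastSigma hξ hw hwind hξw t) hY.comap_le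
    (le_biSup (fun j => MeasurableSpace.comap (w j) inferInstance) (Set.mem_Ici.2 le_rfl))

theorem pastSigma_le [MeasurableSpace Ω] {ξ : Ω → β} {w : ℕ → Ω → γ} (hξ : Measurable ξ) (hw : ∀ t, Measurable (w t))
    (t : ℕ) : pastSigma ξ w t ≤ (inferInstance : MeasurableSpace Ω) :=
  sup_le hξ.comap_le (iSup₂_le fun j _ => (hw j).comap_le)

end Noise

section Gaussian

variable {n : ℕ} {Ω : Type*} [MeasurableSpace Ω] {P : Measure Ω} {W : Ω → Fin n → ℝ}
  {Q : Matrix (Fin n) (Fin n) ℝ}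

theorem gaussianLaw_zero (Q : Matrix (Fin n) (Fin n) ℝ) :
    gaussianLaw 0 Q = (multivariateGaussian (0 : EuclideanSpace ℝ (Fin n)) Q).map WithLp.ofLp := by
  rw [gaussianLaw, WithLp.toLp_zero]

theorem measurable_ofLp_euclidean : Measurable (WithLp.ofLp : EuclideanSpace ℝ (Fin n) → _) := by
  fun_prop

theorem integral_eval_multivariateGaussian_zero (Q : Matrix (Fin n) (Fin n) ℝ) (i : Fin n) :
    ∫ x : EuclideanSpace ℝ (Fin n), x.ofLp i ∂(multivariateGaussian 0 Q) = 0 := by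
  have h := (EuclideanSpace.proj (𝕜 := ℝ) i).integral_comp_comm
    (IsGaussian.integrable_id (μ := multivariateGaussian (0 : EuclideanSpace ℝ (Fin n)) Q))
  simpa using h

theorem memLp_eval_of_map_eq_gaussianLaw (hW : Measurable W) (h : P.map W = gaussianLaw 0 Q)
    (i : Fin n) : MemLp (fun ω => W ω i) 2 P := by
  have h1 : MemLp (fun y : Fin n → ℝ => y i) 2 (P.map W) := by
    rw [h, gaussianLaw_zero]
    refine (memLp_map_measure_iff (measurable_pi_apply i).aestronglyMeasurable
      measurable_ofLp_euclidean.aemeasurable).2 ?_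
    exact (IsGaussian.memLp_id (multivariateGaussian (0 : EuclideanSpace ℝ (Fin n)) Q) 2
      (by simp)).eval_piLp i
  exact h1.comp_of_map hW.aemeasurable

theorem integral_eval_of_map_eq_gaussianLaw (hW : Measurable W) (h : P.map W = gaussianLaw 0 Q)
    (i : Fin n) : ∫ ω, W ω i ∂P = 0 := by
  have h1 : ∫ ω, W ω i ∂P = ∫ y : Fin n → ℝ, y i ∂(P.map W) :=
    (integral_map hW.aemeasurable (measurable_pi_apply i).aestronglyMeasurable).symm
  rw [h1, h, gaussianLaw_zero, integral_map measurable_ofLp_euclidean.aemeasurable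
    (measurable_pi_apply i).aestronglyMeasurable, integral_eval_multivariateGaussian_zero]

theorem integral_mul_eval_of_map_eq_gaussianLaw (hQ : Q.PosSemidef) (hW : Measurable W)
    (h : P.map W = gaussianLaw 0 Q) (i j : Fin n) : ∫ ω, W ω i * W ω j ∂P = Q i j := by
  have hm : Measurable (fun y : Fin n → ℝ => y i * y j) :=
    (measurable_pi_apply i).mul (measurable_pi_apply j)
  have h1 : ∫ ω, W ω i * W ω j ∂P = ∫ y : Fin n → ℝ, y i * y j ∂(P.map W) :=
    (integral_map hW.aemeasurable hm.aestronglyMeasurable).symm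
  rw [h1, h, gaussianLaw_zero, integral_map measurable_ofLp_euclidean.aemeasurable
    hm.aestronglyMeasurable, ← covariance_eval_multivariateGaussian (μ := 0) hQ i j, covariance]
  simp only [integral_eval_multivariateGaussian_zero, sub_zero]

/-- Linear functionals of a centred Gaussian vector are sub-Gaussian. -/
theorem exists_hasSubgaussianMGF_dotProduct (Q : Matrix (Fin n) (Fin n) ℝ) (a : Fin n → ℝ) :
    ∃ c : NNReal, 0 < c ∧ HasSubgaussianMGF (fun y => a ⬝ᵥ y) c (gaussianLaw 0 Q) := by
  set G := multivariateGaussian (0 : EuclideanSpace ℝ (Fin n)) Q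
  let L : StrongDual ℝ (EuclideanSpace ℝ (Fin n)) := innerSL ℝ (WithLp.toLp 2 a)
  have ha : Continuous (fun y : Fin n → ℝ => a ⬝ᵥ y) :=
    continuous_const.dotProduct continuous_id
  have hL : (fun y => a ⬝ᵥ y) ∘ WithLp.ofLp = L := funext fun x => by
    simp [L, EuclideanSpace.inner_eq_star_dotProduct, dotProduct_comm]
  have hmean : ∫ x, L x ∂G = 0 := by
    have := L.integral_comp_comm (IsGaussian.integrable_id (μ := G))
    simp only [id_eq] at this
    rw [this, integral_id_multivariateGaussian]
    exact map_zero L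
  have hmap := IsGaussian.map_eq_gaussianReal (μ := G) L
  rw [hmean] at hmap
  refine ⟨Var[L; G].toNNReal + 1, by positivity, ?_⟩
  rw [← HasSubgaussianMGF.id_map_iff ha.aemeasurable, gaussianLaw_zero,
    Measure.map_map ha.measurable measurable_ofLp_euclidean, hL, hmap]
  refine ⟨fun t => integrable_exp_mul_gaussianReal t, fun t => ?_⟩
  rw [mgf_id_gaussianReal]
  refine Real.exp_le_exp.2 ?_
  push_cast
  nlinarith [sq_nonneg t]

end Gaussian

section SecondMoments

variable {n : ℕ} {Ω : Type*} [MeasurableSpace Ω] {P : Measure Ω}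

/-- The matrix of second moments `E[Y Yᵀ]`. -/
noncomputable def secondMoment (P : Measure Ω) (Y : Ω → Fin n → ℝ) : Matrix (Fin n) (Fin n) ℝ :=
  Matrix.of fun i j => ∫ ω, Y ω i * Y ω j ∂P

/-- The mean vector `E[Y]`, coordinate by coordinate. -/
noncomputable def meanVector (P : Measure Ω) (Y : Ω → Fin n → ℝ) : Fin n → ℝ :=
  fun i => ∫ ω, Y ω i ∂P

theorem memLp_mulVec {Y : Ω → Fin n → ℝ} (hY : ∀ i, MemLp (fun ω => Y ω i) 2 P)
    (M : Matrix (Fin n) (Fin n) ℝ) (i : Fin n) : MemLp (fun ω => (M *ᵥ Y ω) i) 2 P := by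
  simp only [mulVec, dotProduct]
  exact memLp_finsetSum _ fun j _ => (hY j).const_mul (M i j)

theorem meanVector_mulVec [IsProbabilityMeasure P] {Y : Ω → Fin n → ℝ} (hY : ∀ i, MemLp (fun ω => Y ω i) 2 P)
    (M : Matrix (Fin n) (Fin n) ℝ) : meanVector P (fun ω => M *ᵥ Y ω) = M *ᵥ meanVector P Y := by
  ext i
  simp only [meanVector, mulVec, dotProduct]
  rw [integral_finsetSum _ fun j _ => ((hY j).integrable one_le_two).const_mul (M i j)]
  simp only [integral_const_mul]

theorem secondMoment_mulVec {Y : Ω → Fin n → ℝ} (hY : ∀ i, MemLp (fun ω => Y ω i) 2 P)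
    (M : Matrix (Fin n) (Fin n) ℝ) :
    secondMoment P (fun ω => M *ᵥ Y ω) = M * secondMoment P Y * Mᵀ := by
  ext i j
  have hint : ∀ k l, Integrable (fun ω => M i k * M j l * (Y ω k * Y ω l)) P := fun k l =>
    ((hY k).integrable_mul (hY l)).const_mul _
  have e : ∀ ω, (M *ᵥ Y ω) i * (M *ᵥ Y ω) j =
      ∑ l, ∑ k, M i k * M j l * (Y ω k * Y ω l) := by
    intro ω
    simp only [mulVec, dotProduct]
    rw [Finset.sum_mul_sum, Finset.sum_comm]
    exact Finset.sum_congr rfl fun l _ => Finset.sum_congr rfl fun k _ => by ring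
  simp only [secondMoment, of_apply, mul_apply, transpose_apply, e]
  rw [integral_finsetSum _ fun l _ => integrable_finsetSum _ fun k _ => hint k l]
  refine Finset.sum_congr rfl fun l _ => ?_
  rw [integral_finsetSum _ fun k _ => hint k l, Finset.sum_mul]
  refine Finset.sum_congr rfl fun k _ => ?_
  rw [integral_const_mul]
  ring

theorem meanVector_add [IsProbabilityMeasure P] {Y W : Ω → Fin n → ℝ} (hY : ∀ i, MemLp (fun ω => Y ω i) 2 P)
    (hW : ∀ i, MemLp (fun ω => W ω i) 2 P) :
    meanVector P (fun ω => Y ω + W ω) = meanVector P Y + meanVector P W := by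
  ext i
  exact integral_add ((hY i).integrable one_le_two) ((hW i).integrable one_le_two)

theorem secondMoment_add_of_indepFun [IsProbabilityMeasure P] {Y W : Ω → Fin n → ℝ} (hY : ∀ i, MemLp (fun ω => Y ω i) 2 P)
    (hW : ∀ i, MemLp (fun ω => W ω i) 2 P) (hind : IndepFun Y W P) (hW0 : meanVector P W = 0) :
    secondMoment P (fun ω => Y ω + W ω) = secondMoment P Y + secondMoment P W := by
  have hcross : ∀ i j, ∫ ω, Y ω i * W ω j ∂P = 0 := by
    intro i j
    have h : IndepFun (fun ω => Y ω i) (fun ω => W ω j) P :=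
      hind.comp (measurable_pi_apply i) (measurable_pi_apply j)
    have h0 : ∫ ω, W ω j ∂P = 0 := congrFun hW0 j
    rw [h.integral_fun_mul_eq_mul_integral (hY i).1 (hW j).1, h0, mul_zero]
  ext i j
  simp only [secondMoment, of_apply, Matrix.add_apply, Pi.add_apply]
  have e : ∀ ω, (Y ω i + W ω i) * (Y ω j + W ω j) =
      Y ω i * Y ω j + W ω i * W ω j + (Y ω i * W ω j + Y ω j * W ω i) := fun ω => by ring
  have i1 : ∀ i j, Integrable (fun ω => Y ω i * Y ω j) P := fun i j => (hY i).integrable_mul (hY j)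
  have i2 : ∀ i j, Integrable (fun ω => W ω i * W ω j) P := fun i j => (hW i).integrable_mul (hW j)
  have i3 : ∀ i j, Integrable (fun ω => Y ω i * W ω j) P := fun i j => (hY i).integrable_mul (hW j)
  simp only [e]
  rw [integral_add (f := fun ω => Y ω i * Y ω j + W ω i * W ω j)
    (g := fun ω => Y ω i * W ω j + Y ω j * W ω i) ((i1 i j).add (i2 i j)) ((i3 i j).add (i3 j i)), integral_add (i1 i j) (i2 i j),
    integral_add (i3 i j) (i3 j i), hcross, hcross, add_zero, add_zero]

theorem integrable_dotProduct_self {Y : Ω → Fin n → ℝ} (hY : ∀ i, MemLp (fun ω => Y ω i) 2 P) :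
    Integrable (fun ω => Y ω ⬝ᵥ Y ω) P :=
  integrable_finsetSum _ fun i _ => (hY i).integrable_mul (hY i)

theorem integral_dotProduct_self_add_const [IsProbabilityMeasure P] {Y : Ω → Fin n → ℝ}
    (hY : ∀ i, MemLp (fun ω => Y ω i) 2 P) (v : Fin n → ℝ) :
    ∫ ω, (Y ω + v) ⬝ᵥ (Y ω + v) ∂P =
      (secondMoment P Y).trace + 2 * (v ⬝ᵥ meanVector P Y) + v ⬝ᵥ v := by
  have e : ∀ ω, (Y ω + v) ⬝ᵥ (Y ω + v) = ∑ i, (Y ω i * Y ω i + 2 * v i * Y ω i + v i * v i) :=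
    fun ω => Finset.sum_congr rfl fun i _ => by simp only [Pi.add_apply]; ring
  have i1 : ∀ i, Integrable (fun ω => Y ω i * Y ω i) P := fun i => (hY i).integrable_mul (hY i)
  have i2 : ∀ i, Integrable (fun ω => 2 * v i * Y ω i) P := fun i =>
    ((hY i).integrable one_le_two).const_mul _
  have i3 : ∀ i, Integrable (fun ω => Y ω i * Y ω i + 2 * v i * Y ω i) P := fun i =>
    (i1 i).add (i2 i)
  have i4 : ∀ i, Integrable (fun ω => Y ω i * Y ω i + 2 * v i * Y ω i + v i * v i) P := fun i =>
    (i3 i).add (integrable_const _)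
  simp only [e]
  rw [integral_finsetSum _ fun i _ => i4 i]
  simp only [trace, diag_apply, secondMoment, of_apply, dotProduct, meanVector, Finset.mul_sum]
  rw [← Finset.sum_add_distrib, ← Finset.sum_add_distrib]
  refine Finset.sum_congr rfl fun i _ => ?_
  rw [integral_add (i3 i) (integrable_const _), integral_add (i1 i) (i2 i),
    integral_const_mul, integral_const, probReal_univ, one_smul, mul_assoc]

/-- The second moments of a stable linear recursion driven by centred noise which is independent of
the present: existence and value of the ergodic reward. -/
theorem tendsto_averageReward_of_recursion [IsProbabilityMeasure P] {M Q Sig : Matrix (Fin n) (Fin n) ℝ} (hM : IsSchur M)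
    (hSig : Sig = M * Sig * Mᵀ + Q) {X w : ℕ → Ω → Fin n → ℝ} {c : Fin n → ℝ}
    (hX : ∀ t ω, X (t + 1) ω = M *ᵥ X t ω + c + w t ω)
    (hX0 : ∀ i, MemLp (fun ω => X 0 ω i) 2 P) (hw2 : ∀ t i, MemLp (fun ω => w t ω i) 2 P)
    (hw0 : ∀ t, meanVector P (w t) = 0) (hwQ : ∀ t, secondMoment P (w t) = Q)
    (hind : ∀ t, IndepFun (X t) (w t) P) :
    (∀ t, Integrable (fun ω => -(X t ω ⬝ᵥ X t ω)) P) ∧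
      Tendsto (averageReward P X) atTop
        (𝓝 (-(Sig.trace + ((1 - M)⁻¹ *ᵥ c) ⬝ᵥ ((1 - M)⁻¹ *ᵥ c)))) := by
  set v := (1 - M)⁻¹ *ᵥ c with hv
  have hvc : M *ᵥ v + c = v := by
    have h : (1 - M) *ᵥ v = c := by
      rw [hv, mulVec_mulVec, Matrix.mul_nonsing_inv _
        ((Matrix.isUnit_iff_isUnit_det _).1 hM.isUnit_one_sub), one_mulVec]
    rw [sub_mulVec, one_mulVec] at h
    rw [← h]; abel
  have hX2 : ∀ t i, MemLp (fun ω => X t ω i) 2 P := by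
    intro t
    induction t with
    | zero => exact hX0
    | succ t ih =>
      intro i
      simp only [hX, Pi.add_apply]
      exact ((memLp_mulVec ih M i).add (memLp_const _)).add (hw2 t i)
  set Y : ℕ → Ω → Fin n → ℝ := fun t ω => X t ω - v with hYdef
  have hY2 : ∀ t i, MemLp (fun ω => Y t ω i) 2 P := fun t i => (hX2 t i).sub (memLp_const _)
  have hY : ∀ t, Y (t + 1) = fun ω => M *ᵥ Y t ω + w t ω := by
    intro t
    funext ω
    simp only [hYdef, hX, mulVec_sub]
    nth_rewrite 1 [← hvc]
    abel
  have hYind : ∀ t, IndepFun (fun ω => M *ᵥ Y t ω) (w t) P := fun t =>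
    (hind t).comp (φ := fun x => M *ᵥ (x - v)) (ψ := id)
      (Continuous.measurable (by fun_prop)) measurable_id
  have hmean : ∀ t, meanVector P (Y t) = M ^ t *ᵥ meanVector P (Y 0) := by
    intro t
    induction t with
    | zero => simp
    | succ t ih =>
      rw [hY, meanVector_add (memLp_mulVec (hY2 t) M) (hw2 t), hw0, add_zero,
        meanVector_mulVec (hY2 t), ih, mulVec_mulVec, ← pow_succ']
  have hsec : ∀ t, secondMoment P (Y t) =
      Sig + M ^ t * (secondMoment P (Y 0) - Sig) * (M ^ t)ᵀ := by
    intro t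
    induction t with
    | zero => simp
    | succ t ih =>
      rw [hY, secondMoment_add_of_indepFun (memLp_mulVec (hY2 t) M) (hw2 t) (hYind t) (hw0 t), hwQ,
        secondMoment_mulVec (hY2 t), ih, pow_succ', Matrix.transpose_mul]
      nth_rewrite 3 [hSig]
      simp only [Matrix.mul_add, Matrix.add_mul, Matrix.mul_assoc]
      abel
  have hmean0 : Tendsto (fun t => meanVector P (Y t)) atTop (𝓝 0) := by
    refine Tendsto.congr (fun t => (hmean t).symm) ?_
    have h : Tendsto (fun t : ℕ => M ^ t *ᵥ meanVector P (Y 0)) atTop (𝓝 (0 *ᵥ _)) :=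
      ((continuous_id.matrix_mulVec continuous_const).tendsto 0).comp hM.tendsto_pow
    rwa [zero_mulVec] at h
  have hsec0 : Tendsto (fun t => secondMoment P (Y t)) atTop (𝓝 Sig) := by
    refine Tendsto.congr (fun t => (hsec t).symm) ?_
    simpa using (hM.tendsto_pow_mul_mul_pow (secondMoment P (Y 0) - Sig)).const_add Sig
  have hint : ∀ t, Integrable (fun ω => -(X t ω ⬝ᵥ X t ω)) P := fun t =>
    (integrable_dotProduct_self (hX2 t)).neg
  refine ⟨hint, ?_⟩
  have hval : ∀ t, ∫ ω, -(X t ω ⬝ᵥ X t ω) ∂P =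
      -((secondMoment P (Y t)).trace + 2 * (v ⬝ᵥ meanVector P (Y t)) + v ⬝ᵥ v) := by
    intro t
    rw [integral_neg, ← integral_dotProduct_self_add_const (hY2 t) v]
    simp [hYdef]
  have hlim : Tendsto (fun t => ∫ ω, -(X t ω ⬝ᵥ X t ω) ∂P) atTop
      (𝓝 (-(Sig.trace + v ⬝ᵥ v))) := by
    simp only [hval]
    have h1 : Tendsto (fun t => (secondMoment P (Y t)).trace) atTop (𝓝 Sig.trace) :=
      (continuous_id.matrix_trace.tendsto Sig).comp hsec0
    have h2 : Tendsto (fun t => v ⬝ᵥ meanVector P (Y t)) atTop (𝓝 (v ⬝ᵥ 0)) :=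
      ((Continuous.dotProduct continuous_const continuous_id).tendsto 0).comp hmean0
    rw [dotProduct_zero] at h2
    simpa using ((h1.add (h2.const_mul 2)).add_const (v ⬝ᵥ v)).neg
  refine hlim.cesaro.congr fun N => ?_
  rw [averageReward, integral_const_mul, integral_finsetSum _ fun t _ => hint t]

end SecondMoments

namespace LinearSystem

variable {n m k : ℕ} (S : LinearSystem n m k) {Ω : Type*}

theorem measurable_state (ξ : Ω → (Fin n → ℝ)) (w : ℕ → Ω → (Fin n → ℝ)) (α₀ α₁ : Fin m → ℝ)
    (ν : ℕ∞) (t : ℕ) : Measurable[pastSigma ξ w t] (S.state ξ w α₀ α₁ ν t) := by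
  induction t with
  | zero => exact measurable_pastSigma_initial ξ w 0
  | succ t ih =>
    have h1 : Measurable[pastSigma ξ w (t + 1)] (S.state ξ w α₀ α₁ ν t) :=
      ih.mono (pastSigma_mono ξ w t.le_succ) le_rfl
    have h2 := measurable_pastSigma_noise ξ w t
    have h3 : Measurable (fun p : (Fin n → ℝ) × (Fin n → ℝ) =>
        S.A *ᵥ p.1 + S.B *ᵥ (S.K *ᵥ p.1 + (if ν ≤ (t : ℕ∞) then α₁ else α₀)) +
          (if ν ≤ (t : ℕ∞) then S.F *ᵥ S.θ else 0) + p.2) :=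
      Continuous.measurable (by fun_prop)
    have e : S.state ξ w α₀ α₁ ν (t + 1) = (fun p : (Fin n → ℝ) × (Fin n → ℝ) =>
        S.A *ᵥ p.1 + S.B *ᵥ (S.K *ᵥ p.1 + (if ν ≤ (t : ℕ∞) then α₁ else α₀)) +
          (if ν ≤ (t : ℕ∞) then S.F *ᵥ S.θ else 0) + p.2) ∘
        fun ω => (S.state ξ w α₀ α₁ ν t ω, w t ω) := by
      funext ω
      simp only [state, Function.comp_apply]
    rw [e]
    exact h3.comp (h1.prodMk h2)

theorem state_succ_before (ξ : Ω → (Fin n → ℝ)) (w : ℕ → Ω → (Fin n → ℝ)) (α₀ α₁ : Fin m → ℝ)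
    {ν : ℕ∞} {t : ℕ} (h : ¬ν ≤ t) (ω : Ω) : S.state ξ w α₀ α₁ ν (t + 1) ω =
      (S.A + S.B * S.K) *ᵥ S.state ξ w α₀ α₁ ν t ω + S.B *ᵥ α₀ + w t ω := by
  simp only [state, if_neg h, add_mulVec, mulVec_add, mulVec_mulVec]
  abel

theorem state_succ_after (ξ : Ω → (Fin n → ℝ)) (w : ℕ → Ω → (Fin n → ℝ)) (α₀ α₁ : Fin m → ℝ)
    {ν : ℕ∞} {t : ℕ} (h : ν ≤ t) (ω : Ω) : S.state ξ w α₀ α₁ ν (t + 1) ω =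
      (S.A + S.B * S.K) *ᵥ S.state ξ w α₀ α₁ ν t ω + (S.B *ᵥ α₁ + S.F *ᵥ S.θ) + w t ω := by
  simp only [state, if_pos h, add_mulVec, mulVec_add, mulVec_mulVec]
  abel

theorem dotProduct_E_mulVec (x : Fin n → ℝ) : x ⬝ᵥ S.E *ᵥ x =
    ((1 - (S.A + S.B * S.K))⁻¹ *ᵥ x) ⬝ᵥ ((1 - (S.A + S.B * S.K))⁻¹ *ᵥ x) := by
  rw [E, sub_sub, ← mulVec_mulVec, ← mulVec_dotProduct_eq]

variable [MeasurableSpace Ω] {P : Measure Ω} [IsProbabilityMeasure P]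
  {ξ : Ω → (Fin n → ℝ)} {w : ℕ → Ω → (Fin n → ℝ)} {S}

theorem hasErgodicReward_of_recursion (hQ : S.Q.PosDef)
    (hK : IsSchur (S.A + S.B * S.K)) (hξ : Measurable ξ) (hξ2 : ∀ i, MemLp (fun ω => ξ ω i) 2 P)
    (hw : ∀ t, Measurable (w t)) (hwlaw : ∀ t, P.map (w t) = gaussianLaw 0 S.Q)
    (hwind : iIndepFun w P) (hξw : IndepFun ξ (fun ω t => w t ω) P)
    {Sig : Matrix (Fin n) (Fin n) ℝ}
    (hSig : Sig = (S.A + S.B * S.K) * Sig * (S.A + S.B * S.K)ᵀ + S.Q)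
    {α₀ α₁ : Fin m → ℝ} {ν : ℕ∞} {c : Fin n → ℝ}
    (hc : ∀ t ω, S.state ξ w α₀ α₁ ν (t + 1) ω =
      (S.A + S.B * S.K) *ᵥ S.state ξ w α₀ α₁ ν t ω + c + w t ω) :
    HasErgodicReward P (S.state ξ w α₀ α₁ ν) ∧
      ergodicReward P (S.state ξ w α₀ α₁ ν) = -(Sig.trace + c ⬝ᵥ S.E *ᵥ c) := by
  obtain ⟨h1, h2⟩ := tendsto_averageReward_of_recursion hK hSig hc hξ2
    (fun t i => memLp_eval_of_map_eq_gaussianLaw (hw t) (hwlaw t) i)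
    (fun t => funext fun i => integral_eval_of_map_eq_gaussianLaw (hw t) (hwlaw t) i)
    (fun t => Matrix.ext fun i j =>
      integral_mul_eval_of_map_eq_gaussianLaw hQ.posSemidef (hw t) (hwlaw t) i j)
    (fun t => indepFun_of_measurable_pastSigma hξ hw hwind hξw (S.measurable_state ξ w α₀ α₁ ν t))
  rw [← dotProduct_E_mulVec] at h2
  have h3 : ergodicReward P (S.state ξ w α₀ α₁ ν) = -(Sig.trace + c ⬝ᵥ S.E *ᵥ c) := h2.limUnder_eq
  exact ⟨⟨h1, h3 ▸ h2⟩, h3⟩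

end LinearSystem

theorem ProbabilityTheory.HasSubgaussianMGF.mono {Ω : Type*} [MeasurableSpace Ω] {P : Measure Ω}
    {X : Ω → ℝ} {c c' : NNReal} (h : HasSubgaussianMGF X c P) (hc : c ≤ c') :
    HasSubgaussianMGF X c' P :=
  ⟨h.integrable_exp_mul, fun t => (h.mgf_le t).trans (Real.exp_le_exp.2 (by gcongr))⟩

section MaximalInequality

variable {Ω : Type*} [MeasurableSpace Ω] {P : Measure Ω}

theorem measureReal_exists_sum_ge_le {V : ℕ → Ω → ℝ} {c : NNReal} [IsProbabilityMeasure P]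
    (hind : iIndepFun V P) (hsub : ∀ i, HasSubgaussianMGF (V i) c P) (ν n : ℕ) {ε : ℝ}
    (hε : 0 ≤ ε) :
    P.real {ω | ∃ t ≤ n, ε ≤ ∑ i ∈ Finset.Icc ν (ν + t), V i ω} ≤
      (n + 1) * Real.exp (-ε ^ 2 / (2 * ((n + 1) * c))) := by
  have hone : ∀ t ∈ Finset.range (n + 1), P.real {ω | ε ≤ ∑ i ∈ Finset.Icc ν (ν + t), V i ω} ≤
      Real.exp (-ε ^ 2 / (2 * ((n + 1) * c))) := by
    intro t ht
    have h := HasSubgaussianMGF.sum_of_iIndepFun hind (c := fun _ => c)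
      (s := Finset.Icc ν (ν + t)) fun i _ => hsub i
    have hle : ∑ i ∈ Finset.Icc ν (ν + t), c ≤ ((n : NNReal) + 1) * c := by
      rw [Finset.sum_const, Nat.card_Icc, nsmul_eq_mul]
      gcongr
      have : ν + t + 1 - ν ≤ n + 1 := by have := Finset.mem_range.1 ht; omega
      exact_mod_cast this
    have h' := (h.mono hle).measure_ge_le hε
    exact_mod_cast h'
  have hset : {ω | ∃ t ≤ n, ε ≤ ∑ i ∈ Finset.Icc ν (ν + t), V i ω} =
      ⋃ t ∈ Finset.range (n + 1), {ω | ε ≤ ∑ i ∈ Finset.Icc ν (ν + t), V i ω} := by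
    ext ω
    simp
  rw [hset]
  refine (measureReal_biUnion_finset_le _ _).trans ((Finset.sum_le_sum hone).trans ?_)
  simp

end MaximalInequality

theorem tendsto_mul_exp_neg_sq_div {a b c : ℝ} (ha : 0 < a) (hc : 0 < c) :
    Tendsto (fun n : ℕ => ((n : ℝ) + 1) * Real.exp (-(a * n - b) ^ 2 / (2 * ((n + 1) * c))))
      atTop (𝓝 0) := by
  set r := Real.exp (-(a ^ 2 / (2 * c)))
  have hr : r < 1 :=
    (Real.exp_lt_exp.2 (neg_lt_zero.2 (by positivity))).trans_eq Real.exp_zero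
  have h1 : Tendsto (fun n : ℕ => Real.exp (a * (a + b) / c) * (((n + 1 : ℕ) : ℝ) * r ^ (n + 1)))
      atTop (𝓝 0) := by
    have := ((tendsto_self_mul_const_pow_of_lt_one (Real.exp_pos _).le hr).comp
      (tendsto_add_atTop_nat 1)).const_mul (Real.exp (a * (a + b) / c))
    simpa using this
  refine squeeze_zero (fun n => by positivity) (fun n => ?_) h1
  have hle : -(a * n - b) ^ 2 / (2 * ((n + 1) * c)) ≤
      a * (a + b) / c + ((n + 1 : ℕ) : ℝ) * (-(a ^ 2 / (2 * c))) := by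
    have hn : (0 : ℝ) < n + 1 := by positivity
    push_cast
    rw [div_le_iff₀ (by positivity)]
    have e : (a * (a + b) / c + ((n : ℝ) + 1) * (-(a ^ 2 / (2 * c)))) * (2 * ((n + 1) * c)) =
        2 * a * (a + b) * (n + 1) - a ^ 2 * (n + 1) ^ 2 := by
      field_simp
      ring
    rw [e]
    nlinarith [sq_nonneg (a + b)]
  calc ((n : ℝ) + 1) * Real.exp (-(a * n - b) ^ 2 / (2 * ((n + 1) * c)))
      ≤ ((n : ℝ) + 1) * (Real.exp (a * (a + b) / c) * r ^ (n + 1)) := by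
        rw [← Real.exp_nat_mul, ← Real.exp_add]
        gcongr
    _ = _ := by push_cast; ring

section InformationRate

variable {S Ω : Type*} [MeasurableSpace S] [MeasurableSpace Ω] {P : Measure Ω}
  [IsProbabilityMeasure P] {f₀ f₁ : S → S → ℝ} {X : ℕ → ℕ → Ω → S} {I : ℝ}

theorem IsInformationRate.unique {J : ℝ} (hI : IsInformationRate P f₀ f₁ X I)
    (hJ : IsInformationRate P f₀ f₁ X J) : I = J := by
  obtain ⟨ω, h1, h2⟩ := ((hI.1 0).and (hJ.1 0)).exists
  exact tendsto_nhds_unique h1 h2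

theorem IsInformationRate.informationRate_eq (hI : IsInformationRate P f₀ f₁ X I) :
    informationRate P f₀ f₁ X = I := by
  have h : ∃ I, IsInformationRate P f₀ f₁ X I := ⟨I, hI⟩
  rw [informationRate, dif_pos h]
  exact h.choose_spec.unique hI

/-- If the log-likelihood ratios after the change are `I` plus an i.i.d. centred sub-Gaussian
sequence whose terms from the change time on are independent of the past, the information rate
is `I`. -/
theorem isInformationRate_of_iIndepFun {V : ℕ → Ω → ℝ} {c : NNReal} (hI : 0 ≤ I) (hc : 0 < c)
    (hLLR : ∀ ν t, ν ≤ t → ∀ ω, logLikelihoodRatio f₀ f₁ (X ν) t ω = I + V t ω)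
    (hV : ∀ t, Measurable (V t)) (hind : iIndepFun V P)
    (hsub : ∀ i, HasSubgaussianMGF (V i) c P) (hmean : ∀ i, ∫ ω, V i ω ∂P = 0)
    (hlaw : ∀ i j, P.map (V i) = P.map (V j))
    (hX : ∀ ν t, Measurable (X ν t))
    (hpast : ∀ ν, Indep (⨆ i ∈ Set.Ici ν, MeasurableSpace.comap (V i) inferInstance)
      (⨆ j ∈ Set.Iic ν, MeasurableSpace.comap (X ν j) inferInstance) P) :
    IsInformationRate P f₀ f₁ X I := by
  have hsum : ∀ ν t ω, ∑ i ∈ Finset.Icc ν (ν + t), logLikelihoodRatio f₀ f₁ (X ν) i ω =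
      (t + 1) * I + ∑ i ∈ Finset.Icc ν (ν + t), V i ω := by
    intro ν t ω
    rw [Finset.sum_congr rfl fun i hi => hLLR ν i (Finset.mem_Icc.1 hi).1 ω,
      Finset.sum_add_distrib, Finset.sum_const, Nat.card_Icc, nsmul_eq_mul]
    congr 2
    rw [add_assoc, Nat.add_sub_cancel_left]
    push_cast
    rfl
  refine ⟨fun ν => ?_, fun hI0 δ hδ => ?_⟩
  · have hslln := strong_law_ae_real (fun i => V (ν + i)) (hsub _).integrable
      (fun i j hij => hind.indepFun (by simpa using hij))
      (fun i => ⟨(hV _).aemeasurable, (hV _).aemeasurable, hlaw _ _⟩)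
    filter_upwards [hslln] with ω hω
    rw [hmean] at hω
    have h1 : Tendsto (fun n : ℕ => ((n + 1 : ℕ) : ℝ) / n) atTop (𝓝 1) := by
      have h := (tendsto_inv_atTop_nhds_zero_nat (𝕜 := ℝ)).const_add 1
      rw [add_zero] at h
      refine h.congr' ?_
      filter_upwards [eventually_gt_atTop 0] with n hn
      push_cast
      field_simp
    have h2 := h1.mul ((hω.comp (tendsto_add_atTop_nat 1)).const_add I)
    rw [one_mul, add_zero] at h2
    refine h2.congr fun n => ?_
    rw [hsum, ← Finset.Ico_add_one_right_eq_Icc, Finset.sum_Ico_eq_sum_range,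
      show ν + n + 1 - ν = n + 1 by omega]
    simp only [Function.comp_apply]
    push_cast
    field_simp
  · have hIpos : 0 < I := lt_of_le_of_ne hI (Ne.symm hI0)
    have hlim := tendsto_mul_exp_neg_sq_div (a := I * δ) (b := I) (c := c) (by positivity)
      (by exact_mod_cast hc)
    have hlim' := ENNReal.tendsto_ofReal hlim
    rw [ENNReal.ofReal_zero] at hlim'
    refine tendsto_of_tendsto_of_tendsto_of_le_of_le' tendsto_const_nhds hlim'
      (Eventually.of_forall fun _ => zero_le) ?_
    have hev : ∀ᶠ n : ℕ in atTop, 0 ≤ I * δ * n - I := by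
      filter_upwards [eventually_ge_atTop ⌈1 / δ⌉₊] with n hn
      have h := (Nat.ceil_le.1 hn)
      rw [div_le_iff₀ hδ] at h
      nlinarith
    filter_upwards [hev] with n hn
    refine iSup_le fun ν => ?_
    set s := {ω' | ∃ t ≤ n, I * (1 + δ) * n ≤
      ∑ i ∈ Finset.Icc ν (ν + t), logLikelihoodRatio f₀ f₁ (X ν) i ω'} with hs
    have hpastle : (⨆ j ∈ Set.Iic ν, MeasurableSpace.comap (X ν j) inferInstance) ≤
        (inferInstance : MeasurableSpace Ω) := iSup₂_le fun j _ => (hX ν j).comap_le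
    have hfutle : (⨆ i ∈ Set.Ici ν, MeasurableSpace.comap (V i) inferInstance) ≤
        (inferInstance : MeasurableSpace Ω) := iSup₂_le fun j _ => (hV j).comap_le
    have hsm : MeasurableSet[⨆ i ∈ Set.Ici ν, MeasurableSpace.comap (V i) inferInstance] s := by
      have e : s = ⋃ t ∈ Set.Iic n, {ω' | I * (1 + δ) * n ≤
          (t + 1) * I + ∑ i ∈ Finset.Icc ν (ν + t), V i ω'} := by
        ext ω
        simp only [hs, hsum, Set.mem_ofPred_eq, Set.mem_iUnion, Set.mem_Iic, exists_prop]
      rw [e]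
      refine MeasurableSet.biUnion (Set.to_countable _) fun t _ => ?_
      have hm : Measurable[⨆ i ∈ Set.Ici ν, MeasurableSpace.comap (V i) inferInstance]
          fun ω' => ((t : ℝ) + 1) * I + ∑ i ∈ Finset.Icc ν (ν + t), V i ω' := by
        refine measurable_const.add (Finset.measurable_fun_sum _ fun i hi => ?_)
        exact (comap_measurable (V i)).mono
          (le_biSup (fun i => MeasurableSpace.comap (V i) inferInstance)
            (Set.mem_Ici.2 (Finset.mem_Icc.1 hi).1)) le_rfl
      exact hm measurableSet_Ici
    have hcond := condExp_indep_eq hfutle hpastle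
      ((@stronglyMeasurable_const _ _ (_) _ (1 : ℝ)).indicator hsm) (hpast ν)
    have hint : ∫ ω, s.indicator (1 : Ω → ℝ) ω ∂P = P.real s :=
      integral_indicator_one (hfutle s hsm)
    have hbound : P.real s ≤ (n + 1) * Real.exp (-(I * δ * n - I) ^ 2 / (2 * ((n + 1) * c))) := by
      refine (measureReal_mono ?_).trans (measureReal_exists_sum_ge_le hind hsub ν n hn)
      rintro ω ⟨t, ht, hω⟩
      refine ⟨t, ht, ?_⟩
      rw [hsum] at hω
      have htn : (t : ℝ) ≤ n := by exact_mod_cast ht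
      nlinarith
    refine essSup_le_of_ae_le _ ?_
    filter_upwards [hcond] with ω hω
    refine ENNReal.ofReal_le_ofReal (le_trans (le_of_eq ?_) hbound)
    rw [← hint]
    exact hω

end InformationRate

theorem log_gaussianDensity_div {n : ℕ} {Q : Matrix (Fin n) (Fin n) ℝ} (hQ : Q.PosDef)
    {μ₀ μ₁ d y v : Fin n → ℝ} (hd : μ₁ = μ₀ + d) (hy : y = μ₁ + v) :
    Real.log (gaussianDensity μ₁ Q y / gaussianDensity μ₀ Q y) =
      1 / 2 * (d ⬝ᵥ Q⁻¹ *ᵥ d) + (Q⁻¹ *ᵥ d) ⬝ᵥ v := by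
  have hC : 0 < (Real.sqrt ((2 * Real.pi) ^ n * Q.det))⁻¹ :=
    inv_pos.2 (Real.sqrt_pos.2 (mul_pos (by positivity) hQ.det_pos))
  have h1 : y - μ₁ = v := by rw [hy]; abel
  have h0 : y - μ₀ = v + d := by rw [hy, hd]; abel
  rw [gaussianDensity, gaussianDensity, mul_div_mul_left _ _ hC.ne', ← Real.exp_sub, Real.log_exp,
    h1, h0, dotProduct_mulVec_add_add hQ.inv.isHermitian]
  have h2 : (Q⁻¹ *ᵥ d) ⬝ᵥ v = d ⬝ᵥ Q⁻¹ *ᵥ v := by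
    have hT : (Q⁻¹)ᵀ = Q⁻¹ := by simpa using hQ.inv.isHermitian.eq
    rw [dotProduct_mulVec, ← mulVec_transpose, hT]
  rw [h2]
  ring

namespace LinearSystem

variable {n m k : ℕ} {S : LinearSystem n m k} {Ω : Type*} {ξ : Ω → (Fin n → ℝ)}
  {w : ℕ → Ω → (Fin n → ℝ)}

theorem logLikelihoodRatio_state (hQ : S.Q.PosDef) (α₀ α₁ : Fin m → ℝ) {ν t : ℕ} (h : ν ≤ t)
    (ω : Ω) :
    logLikelihoodRatio (S.densityBefore α₀) (S.densityAfter α₁) (S.state ξ w α₀ α₁ (ν : ℕ∞)) t ω =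
      1 / 2 * ((S.F *ᵥ S.θ + S.B *ᵥ (α₁ - α₀)) ⬝ᵥ S.Q⁻¹ *ᵥ (S.F *ᵥ S.θ + S.B *ᵥ (α₁ - α₀))) +
        (S.Q⁻¹ *ᵥ (S.F *ᵥ S.θ + S.B *ᵥ (α₁ - α₀))) ⬝ᵥ w t ω := by
  refine log_gaussianDensity_div hQ ?_ ?_
  · simp only [mulVec_add, mulVec_sub]
    abel
  · have h' : (ν : ℕ∞) ≤ t := by exact_mod_cast h
    simp only [state, if_pos h']

theorem isInformationRate_state [MeasurableSpace Ω] {P : Measure Ω} [IsProbabilityMeasure P]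
    (hQ : S.Q.PosDef) (hξ : Measurable ξ) (hw : ∀ t, Measurable (w t))
    (hwlaw : ∀ t, P.map (w t) = gaussianLaw 0 S.Q) (hwind : iIndepFun w P)
    (hξw : IndepFun ξ (fun ω t => w t ω) P) (α₀ α₁ : Fin m → ℝ) :
    IsInformationRate P (S.densityBefore α₀) (S.densityAfter α₁)
      (fun ν => S.state ξ w α₀ α₁ (ν : ℕ∞))
      (1 / 2 * ((S.F *ᵥ S.θ + S.B *ᵥ (α₁ - α₀)) ⬝ᵥ
        S.Q⁻¹ *ᵥ (S.F *ᵥ S.θ + S.B *ᵥ (α₁ - α₀)))) := by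
  set d := S.F *ᵥ S.θ + S.B *ᵥ (α₁ - α₀)
  set a := S.Q⁻¹ *ᵥ d
  have ha : Measurable (fun y : Fin n → ℝ => a ⬝ᵥ y) :=
    (continuous_const.dotProduct continuous_id).measurable
  obtain ⟨c, hc, hsub⟩ := exists_hasSubgaussianMGF_dotProduct S.Q a
  have hV : ∀ t, Measurable (fun ω => a ⬝ᵥ w t ω) := fun t => ha.comp (hw t)
  refine isInformationRate_of_iIndepFun (V := fun t ω => a ⬝ᵥ w t ω) (c := c)
    (mul_nonneg one_half_pos.le (hQ.inv.dotProduct_mulVec_nonneg' _)) hc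
    (fun ν t h ω => logLikelihoodRatio_state hQ α₀ α₁ h ω) hV
    (hwind.comp (fun _ y => a ⬝ᵥ y) fun _ => ha) (fun i => ?_) (fun i => ?_) (fun i j => ?_)
    (fun ν t => (S.measurable_state ξ w α₀ α₁ ν t).mono (pastSigma_le hξ hw t) le_rfl)
    (fun ν => ?_)
  · exact HasSubgaussianMGF.of_map (X := fun y => a ⬝ᵥ y) (hw i).aemeasurable
      (by rw [hwlaw]; exact hsub)
  · simp only [dotProduct]
    rw [integral_finsetSum _ fun j _ => ((memLp_eval_of_map_eq_gaussianLaw (hw i) (hwlaw i)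
      j).integrable one_le_two).const_mul _]
    simp only [integral_const_mul, integral_eval_of_map_eq_gaussianLaw (hw i) (hwlaw i), mul_zero,
      Finset.sum_const_zero]
  · have h : ∀ i, P.map (fun ω => a ⬝ᵥ w i ω) = (P.map (w i)).map (fun y => a ⬝ᵥ y) := fun i =>
      (Measure.map_map ha (hw i)).symm
    rw [h, h, hwlaw, hwlaw]
  · refine indep_of_indep_of_le (indep_pastSigma hξ hw hwind hξw ν).symm ?_ ?_
    · exact iSup₂_mono fun i _ => (ha.comp (comap_measurable (w i))).comap_le
    · exact iSup₂_le fun j hj => ((S.measurable_state ξ w α₀ α₁ ν j).mono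
        (pastSigma_mono ξ w hj) le_rfl).comap_le

end LinearSystem

theorem proposition4 {n m k : ℕ} (S : LinearSystem n m k)
    (hQ : S.Q.PosDef) (hB : LinearIndependent ℝ S.B.col) (hK : IsSchur (S.A + S.B * S.K))
    {Ω : Type*} [MeasurableSpace Ω] (P : Measure Ω) [IsProbabilityMeasure P]
    (ξ : Ω → (Fin n → ℝ)) (hξ : Measurable ξ) (hξ2 : ∀ i, MemLp (fun ω => ξ ω i) 2 P)
    (w : ℕ → Ω → (Fin n → ℝ)) (hw : ∀ t, Measurable (w t))
    (hwlaw : ∀ t, P.map (w t) = gaussianLaw 0 S.Q) (hwind : iIndepFun w P)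
    (hξw : IndepFun ξ (fun ω t => w t ω) P) :
    -- the two ergodic rewards and the information rate exist
    (∀ α₀ α₁ : Fin m → ℝ,
      HasErgodicReward P (S.state ξ w α₀ α₁ ⊤) ∧
      HasErgodicReward P (S.state ξ w α₀ α₁ 0) ∧
      IsInformationRate P (S.densityBefore α₀) (S.densityAfter α₁)
        (fun ν => S.state ξ w α₀ α₁ (ν : ℕ∞)) (S.limitedInformation P ξ w α₀ α₁)) ∧
    -- the privacy term
    (∀ α₀ α₁ : Fin m → ℝ,
      S.limitedInformation P ξ w α₀ α₁ =
        1 / 2 * ((S.F *ᵥ S.θ + S.B *ᵥ (α₁ - α₀)) ⬝ᵥ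
          S.Q⁻¹ *ᵥ (S.F *ᵥ S.θ + S.B *ᵥ (α₁ - α₀)))) ∧
    -- the value function
    (∃! Sig : Matrix (Fin n) (Fin n) ℝ,
      Sig = (S.A + S.B * S.K) * Sig * (S.A + S.B * S.K)ᵀ + S.Q) ∧
    (∀ Sig : Matrix (Fin n) (Fin n) ℝ,
      Sig = (S.A + S.B * S.K) * Sig * (S.A + S.B * S.K)ᵀ + S.Q →
      ∀ ρ ∈ Set.Icc (0 : ℝ) 1, ∀ lam : ℝ, 0 ≤ lam → ∀ α₀ α₁ : Fin m → ℝ,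
        S.utilityPrivacyValue P ξ w ρ lam α₀ α₁ =
          -(1 - ρ) * (α₀ ⬝ᵥ (S.Bᵀ * S.E * S.B) *ᵥ α₀) - Sig.trace
          - ρ * ((S.B *ᵥ α₁ + S.F *ᵥ S.θ) ⬝ᵥ S.E *ᵥ (S.B *ᵥ α₁ + S.F *ᵥ S.θ))
          - lam * (1 / 2) * ((S.F *ᵥ S.θ + S.B *ᵥ (α₁ - α₀)) ⬝ᵥ
              S.Q⁻¹ *ᵥ (S.F *ᵥ S.θ + S.B *ᵥ (α₁ - α₀)))) ∧
    -- the maximizers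
    (∀ ρ ∈ Set.Icc (0 : ℝ) 1, ∀ lam : ℝ, 0 < lam →
      IsUnit (S.Bᵀ * (S.Q⁻¹ + (2 * (1 - ρ) / lam) • S.E) * S.B) ∧
      IsUnit (S.Bᵀ * S.mixMatrix ρ lam * S.B) ∧
      ∀ α₀ α₁ : Fin m → ℝ,
        (∀ β₀ β₁ : Fin m → ℝ, S.utilityPrivacyValue P ξ w ρ lam β₀ β₁ ≤
          S.utilityPrivacyValue P ξ w ρ lam α₀ α₁) ↔
        α₀ = S.α₀Star ρ lam ∧ α₁ = S.α₁Star ρ lam) ∧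
    -- the simplified forms for `ρ = 0` and `ρ = 1`
    (∀ lam : ℝ, 0 < lam →
      IsUnit (S.Bᵀ * S.Q⁻¹ * S.B) ∧ IsUnit (S.Bᵀ * S.E * S.B) ∧
      S.α₀Star 0 lam = 0 ∧
      S.α₁Star 0 lam = -(S.Btilde 0 S.Q⁻¹ *ᵥ (S.F *ᵥ S.θ)) ∧
      S.α₀Star 1 lam =
        S.Btilde 0 S.Q⁻¹ *ᵥ ((1 - S.B * S.Btilde 0 S.E) *ᵥ (S.F *ᵥ S.θ)) ∧
      S.α₁Star 1 lam = -(S.Btilde 0 S.E *ᵥ (S.F *ᵥ S.θ))) ∧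
    -- the problem in `α₁` alone, with `ρ = 1` and `α₀ = 0`
    (∀ lam : ℝ, 0 < lam →
      IsUnit (S.Bᵀ * ((2 / lam) • S.E + S.Q⁻¹) * S.B) ∧
      ∀ α₁ : Fin m → ℝ,
        (∀ β₁ : Fin m → ℝ, S.utilityPrivacyValue P ξ w 1 lam 0 β₁ ≤
          S.utilityPrivacyValue P ξ w 1 lam 0 α₁) ↔
        α₁ = -(S.Btilde 0 ((2 / lam) • S.E + S.Q⁻¹) *ᵥ (S.F *ᵥ S.θ))) := by
  have hBi : Function.Injective S.B.mulVec := Matrix.mulVec_injective_iff.2 hB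
  obtain ⟨Sig, hSig, hSigu⟩ := hK.existsUnique_lyapunov S.Q
  have hI := fun α₀ α₁ =>
    LinearSystem.isInformationRate_state (S := S) hQ hξ hw hwlaw hwind hξw α₀ α₁
  have hIeq := fun α₀ α₁ => (hI α₀ α₁).informationRate_eq
  have hV₀ := fun α₀ α₁ => LinearSystem.hasErgodicReward_of_recursion (ν := ⊤) hQ hK hξ hξ2 hw
    hwlaw hwind hξw hSig fun t ω => S.state_succ_before ξ w α₀ α₁ (by simp) ω
  have hV₁ := fun α₀ α₁ => LinearSystem.hasErgodicReward_of_recursion (ν := 0) hQ hK hξ hξ2 hw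
    hwlaw hwind hξw hSig fun t ω => S.state_succ_after ξ w α₀ α₁ (by simp) ω
  have hV : ∀ ρ lam α₀ α₁, S.utilityPrivacyValue P ξ w ρ lam α₀ α₁ =
      -inputLoss S.B S.E S.Q⁻¹ (S.F *ᵥ S.θ) ρ lam α₀ α₁ - Sig.trace := by
    intro ρ lam α₀ α₁
    rw [LinearSystem.utilityPrivacyValue, (hV₀ α₀ α₁).2, (hV₁ α₀ α₁).2,
      LinearSystem.limitedInformation, hIeq, inputLoss]
    ring
  refine ⟨fun α₀ α₁ => ⟨(hV₀ α₀ α₁).1, (hV₁ α₀ α₁).1, ?_⟩, hIeq, ⟨Sig, hSig, hSigu⟩, ?_, ?_, ?_, ?_⟩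
  · rw [LinearSystem.limitedInformation, hIeq]
    exact hI α₀ α₁
  · intro Sig' hSig' ρ _ lam _ α₀ α₁
    rw [hSigu Sig' hSig', hV, inputLoss, mulVec_dotProduct_eq, mulVec_mulVec, mulVec_mulVec]
    ring
  · intro ρ hρ lam hlam
    refine ⟨LinearSystem.isUnit_posDef_weight hQ hBi hK hρ.2 hlam,
      LinearSystem.isUnit_mixMatrix hQ hBi hK hρ hlam, fun α₀ α₁ => ?_⟩
    rw [← LinearSystem.forall_inputLoss_le_iff_star hQ hBi hK hρ hlam]
    simp only [hV, sub_le_sub_iff_right, neg_le_neg_iff]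
  · intro lam hlam
    exact ⟨hQ.inv.isUnit_transpose_mul_mul hBi, (S.posDef_E hK).isUnit_transpose_mul_mul hBi,
      LinearSystem.α₀Star_zero hQ hBi hK hlam, LinearSystem.α₁Star_zero hQ hBi hK hlam,
      LinearSystem.α₀Star_one, LinearSystem.α₁Star_one⟩
  · intro lam hlam
    refine ⟨(((S.posDef_E hK).smul (by positivity)).add hQ.inv).isUnit_transpose_mul_mul hBi,
      fun α₁ => ?_⟩
    rw [← LinearSystem.forall_inputLoss_one_le_iff hQ hBi hK hlam]
    simp only [hV, sub_le_sub_iff_right, neg_le_neg_iff]
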